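/- Let $0<T\le\infty$. Consider the shallow water equations on a plane sloping beach, in dimensionless form, $$\partial_t\eta+\partial_x[(x+\eta)u]=0,\qquad \partial_t u+u\,\partial_x u+\partial_x\eta=0,$$ on the wet region $D=\{(x,t): 0\le t<T,\ x\ge x_0(t)\}$, where the shoreline $x_0$ is a continuous function on $[0,T)$ with $x_0(t)+\eta(x_0(t),t)=0$ and $x+\eta(x,t)>0$ for $x>x_0(t)$. Let $(\eta,u)$ be a classical solution that is $C^2$ up to the boundary of $D$ (each of $\eta,u$ is the restriction to $D$ of a function that is $C^2$ near every point of $D$), with initial displacement $\eta(x,0)=\eta_0(x)$ and zero initial velocity $u(x,0)=0$ for $x\ge x_0(0)$. Assume that the wave does not break on $[0,T)$: with $\sigma=\sqrt{x+\eta}$ and $\tau=(t-u)/2$, the Jacobian $\partial(\sigma,\tau)/\partial(x,t)$ of the Carrier–Greenspan map does not vanish at the points of $D$ with $x>x_0(t)$, and $\partial(\sigma^2,\tau)/\partial(x,t)\ne0$ on the shoreline $x=x_0(t)$. Write $v_0=dx_0/dt$ (one-sided at $t=0$), $\theta(t)=(t-v_0(t))/2$, $\Theta=\theta([0,T))$,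 and $(\mathcal A f)(\sigma)=\int_0^\sigma f(s)\,(\sigma^2-s^2)^{-1/2}\,ds$ for the Abel transform. Then: 0. $x_0$ is differentiable and $v_0(t)=u(x_0(t),t)$ for $0\le t<T$. 1. $\theta(0)=0$, $\theta$ is strictly increasing on $[0,T)$ and $\Theta$ is an interval, so that $$\Psi(\tau)=-x_0(t)+v_0(t)^2/2,\qquad \tau=(t-v_0(t))/2,$$ defines a function $\Psi$ on $\Theta$ in terms of the shoreline motion alone. 2. For every $\sigma\in\Theta$ the equation $x+\eta_0(x)=\sigma^2$ has exactly one solution $x=\gamma(\sigma)\ge x_0(0)$. Put $\psi_0(\sigma)=\eta_0(\gamma(\sigma))$. For every $\sigma\in\Theta$ with $\sigma>0$ the integral $(\mathcal A\Psi)(\sigma)$ converges absolutely and $$\psi_0(\sigma)=\frac2\pi(\mathcal A\Psi)(\sigma).$$ 3. For every $x>x_0(0)$ with $\sqrt{x+\eta_0(x)}\in\Theta$, $$\eta_0(x)=\psi_0(\sigma)=\frac2\pi(\mathcal A\Psi)(\sigma),\qquad \sigma=\sqrt{x+\eta_0(x)},$$ and $y=\eta_0(x)$ is the only real number with $x+y>0$,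 $\sqrt{x+y}\in\Theta$ and $y=\frac2\pi(\mathcal A\Psi)(\sqrt{x+y})$. Moreover $\eta_0(x_0(0))=-x_0(0)$. 4. If $T=\infty$, then $\sqrt{x+\eta_0(x)}\in\Theta$ for every $x\ge x_0(0)$, so that the whole initial displacement is determined by the shoreline motion. -/

import Mathlib

namespace SlopingBeach

noncomputable section

/-- The time interval `[0, T)`, where `T = ⊤` gives all times `t ≥ 0`. -/
def times (T : EReal) : Set ℝ := {t | 0 ≤ t ∧ (t : EReal) < T}

/-- The wet region, with points written `(x, t)`; the shoreline `x = x₀ t` is included. -/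
def wet (T : EReal) (x₀ : ℝ → ℝ) : Set (ℝ × ℝ) := {p | p.2 ∈ times T ∧ x₀ p.2 ≤ p.1}

/-- Partial derivative in the first variable `x`. -/
def dx (f : ℝ → ℝ → ℝ) (x t : ℝ) : ℝ := deriv (fun y => f y t) x

/-- Partial derivative in the second variable `t`. -/
def dt (f : ℝ → ℝ → ℝ) (x t : ℝ) : ℝ := deriv (fun s => f x s) t

/-- The total depth `H(x, t) = x + η(x, t)`. -/
def depth (η : ℝ → ℝ → ℝ) (x t : ℝ) : ℝ := x + η x t

/-- `(η, u)` is a classical solution, of class `C²` up to the boundary of the wet region, of the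
shallow water equations over the plane beach on `[0, T)`, with moving shoreline `x₀`.
Regularity up to the boundary means that `η` and `u` are restrictions of functions which are `C²`
near each point of the wet region; the values outside the wet region are irrelevant. -/
structure IsFlow (T : EReal) (η u : ℝ → ℝ → ℝ) (x₀ : ℝ → ℝ) : Prop where
  shore_cont : ContinuousOn x₀ (times T)
  shore_eq : ∀ t ∈ times T, depth η (x₀ t) t = 0
  depth_pos : ∀ t ∈ times T, ∀ x, x₀ t < x → 0 < depth η x t
  smooth_η : ∀ p ∈ wet T x₀, ContDiffAt ℝ 2 (fun q : ℝ × ℝ => η q.1 q.2) p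
  smooth_u : ∀ p ∈ wet T x₀, ContDiffAt ℝ 2 (fun q : ℝ × ℝ => u q.1 q.2) p
  continuity_eq : ∀ p ∈ wet T x₀,
    dt η p.1 p.2 + dx (fun x t => (x + η x t) * u x t) p.1 p.2 = 0
  momentum_eq : ∀ p ∈ wet T x₀,
    dt u p.1 p.2 + u p.1 p.2 * dx u p.1 p.2 + dx η p.1 p.2 = 0

/-- The hodograph coordinate `σ = √(x + η)`. -/
def cgσ (η : ℝ → ℝ → ℝ) (x t : ℝ) : ℝ := Real.sqrt (depth η x t)

/-- The hodograph coordinate `τ = (t - u) / 2`. -/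
def cgτ (u : ℝ → ℝ → ℝ) (x t : ℝ) : ℝ := (t - u x t) / 2

/-- The Jacobian determinant `∂(f, g) / ∂(x, t)`. -/
def jac (f g : ℝ → ℝ → ℝ) (x t : ℝ) : ℝ := dx f x t * dt g x t - dt f x t * dx g x t

/-- The wave does not break: the Carrier–Greenspan map `(x, t) ↦ (σ, τ)` has non-zero Jacobian
off the shoreline. On the shoreline, where the square root `σ` is not differentiable, the
condition is imposed on `(σ², τ)`, whose Jacobian is `2σ` times that of `(σ, τ)`. -/
structure NoBreaking (T : EReal) (η u : ℝ → ℝ → ℝ) (x₀ : ℝ → ℝ) : Prop where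
  interior : ∀ t ∈ times T, ∀ x, x₀ t < x → jac (cgσ η) (cgτ u) x t ≠ 0
  shore : ∀ t ∈ times T, jac (depth η) (cgτ u) (x₀ t) t ≠ 0

/-- The shoreline velocity `v₀ = dx₀/dt` (one-sided at `t = 0`). -/
def shoreVel (x₀ : ℝ → ℝ) (t : ℝ) : ℝ := derivWithin x₀ (Set.Ici 0) t

/-- The delayed time at the shoreline, `(t - v₀(t)) / 2`. -/
def shoreτ (x₀ : ℝ → ℝ) (t : ℝ) : ℝ := (t - shoreVel x₀ t) / 2

/-- The set of values of the delayed time `τ` observed at the shoreline during `[0, T)`. -/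
def observed (T : EReal) (x₀ : ℝ → ℝ) : Set ℝ := shoreτ x₀ '' times T

/-- The function `Ψ`, computed from the shoreline motion only:
`Ψ(τ) = -x₀(t) + v₀(t)² / 2`, where `t ∈ [0, T)` solves `τ = (t - v₀(t)) / 2`. -/
def shoreΨ (T : EReal) (x₀ : ℝ → ℝ) (τ : ℝ) : ℝ :=
  -x₀ (Function.invFunOn (shoreτ x₀) (times T) τ)
    + shoreVel x₀ (Function.invFunOn (shoreτ x₀) (times T) τ) ^ 2 / 2

/-- The Abel transform. -/
def abel (f : ℝ → ℝ) (x : ℝ) : ℝ := ∫ s in (0 : ℝ)..x, f s / Real.sqrt (x ^ 2 - s ^ 2)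

/-- `γ(σ)` is the solution `x ≥ a` of `x + η₀(x) = σ²`, where `a` is the initial shoreline. -/
def initγ (a : ℝ) (η₀ : ℝ → ℝ) (σ : ℝ) : ℝ :=
  Function.invFunOn (fun x => x + η₀ x) (Set.Ici a) (σ ^ 2)

/-- `ψ₀(σ) = η₀(γ(σ))`: the initial data in the hodograph plane for zero initial velocity. -/
def initψ (a : ℝ) (η₀ : ℝ → ℝ) (σ : ℝ) : ℝ := η₀ (initγ a η₀ σ)

end

end SlopingBeach

/-! The Riemann invariants are τ ± σ. Writing both Jacobians with the help of the equations of
motion, the absence of breaking becomes σ|u_x| < 1 + η_x on the whole wet region (`slope_pos`).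
Hence θ is strictly increasing in time, while at fixed time τ + σ increases and τ - σ decreases in
x.

The hodograph map is never inverted. Instead, for S = θ(t₁), the density √((S - τ)² - σ²) is
conserved with velocity u - (S - τ) (`balance`). It is integrated over the region between the
shoreline and the characteristic τ + σ = S that lands at time t₁, outside of which it is extended by
zero. Only t = 0 (where τ = 0) and the shoreline (where σ = 0) contribute, so that ∫ √(S² - x -
η₀(x)) dx = ∫₀^{t₁} (S - θ)² dt (`integral_sqrt_eq`).

The same holds for every R ≤ S. Differentiate in R and integrate against 1/√(S² - R²): by a Beta
integral the left side becomes (π/2)(γ(S) - x₀(0)) (`abel_of_integral_identity`). On the right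
stands the Abel transform of 2∫(R - θ)₊ dt, which equals -x₀(0) + 2R² - Ψ(R) because v₀ = t - 2θ
(`shoreΨ_eq`). Together these give 𝒜Ψ(S) = (π/2)(S² - γ(S)) = (π/2)ψ₀(S).

For T = ∞, suppose that θ stayed below some initial σ. The left side of the identity is semiconcave
in R with a constant C depending on the initial data only (`exists_second_difference_le`). The right
side has second differences at least 2d²t₁ (`second_difference_ge`), which is absurd for large t₁.
-/

namespace SlopingBeach

open Set Filter Topology MeasureTheory

/-! ### Partial derivatives, chain rules and level sets. -/

section Calculus

variable {f : ℝ → ℝ → ℝ} {x t : ℝ}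

theorem hasFDerivAt_partials (h : ContDiffAt ℝ 2 (fun q : ℝ × ℝ => f q.1 q.2) (x, t)) :
    HasFDerivAt (fun q : ℝ × ℝ => f q.1 q.2)
      (dx f x t • ContinuousLinearMap.fst ℝ ℝ ℝ + dt f x t • ContinuousLinearMap.snd ℝ ℝ ℝ)
      (x, t) := by
  have hd := (h.differentiableAt (by norm_num)).hasFDerivAt
  have h1 : HasDerivAt (fun y => f y t)
      (fderiv ℝ (fun q : ℝ × ℝ => f q.1 q.2) (x, t) (1, 0)) x :=
    HasFDerivAt.comp_hasDerivAt (l := fun q : ℝ × ℝ => f q.1 q.2) (f := fun y => (y, t)) x hd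
      ((hasDerivAt_id x).prodMk (hasDerivAt_const x t))
  have h2 : HasDerivAt (fun r => f x r)
      (fderiv ℝ (fun q : ℝ × ℝ => f q.1 q.2) (x, t) (0, 1)) t :=
    HasFDerivAt.comp_hasDerivAt (l := fun q : ℝ × ℝ => f q.1 q.2) (f := fun r => (x, r)) t hd
      ((hasDerivAt_const t x).prodMk (hasDerivAt_id t))
  refine hd.congr_fderiv ?_
  ext
  · simp [dx, h1.deriv]
  · simp [dt, h2.deriv]

theorem hasDerivWithinAt_along (h : ContDiffAt ℝ 2 (fun q : ℝ × ℝ => f q.1 q.2) (x, t))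
    {X Y : ℝ → ℝ} {X' Y' r : ℝ} {s : Set ℝ} (hX : HasDerivWithinAt X X' s r)
    (hY : HasDerivWithinAt Y Y' s r) (hx : X r = x) (ht : Y r = t) :
    HasDerivWithinAt (fun r => f (X r) (Y r)) (dx f x t * X' + dt f x t * Y') s r := by
  subst hx ht
  have := HasFDerivAt.comp_hasDerivWithinAt (l := fun q : ℝ × ℝ => f q.1 q.2)
    (f := fun r => (X r, Y r)) r (hasFDerivAt_partials h) (hX.prodMk hY)
  exact this.congr_deriv (by simp)

theorem hasDerivAt_along (h : ContDiffAt ℝ 2 (fun q : ℝ × ℝ => f q.1 q.2) (x, t))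
    {X Y : ℝ → ℝ} {X' Y' r : ℝ} (hX : HasDerivAt X X' r)
    (hY : HasDerivAt Y Y' r) (hx : X r = x) (ht : Y r = t) :
    HasDerivAt (fun r => f (X r) (Y r)) (dx f x t * X' + dt f x t * Y') r := by
  rw [← hasDerivWithinAt_univ] at *
  exact hasDerivWithinAt_along h hX hY hx ht

theorem hasDerivAt_dx (h : ContDiffAt ℝ 2 (fun q : ℝ × ℝ => f q.1 q.2) (x, t)) :
    HasDerivAt (fun y => f y t) (dx f x t) x := by
  simpa using hasDerivAt_along h (hasDerivAt_id x) (hasDerivAt_const x t) rfl rfl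

theorem hasDerivAt_dt (h : ContDiffAt ℝ 2 (fun q : ℝ × ℝ => f q.1 q.2) (x, t)) :
    HasDerivAt (fun r => f x r) (dt f x t) t := by
  simpa using hasDerivAt_along h (hasDerivAt_const t x) (hasDerivAt_id t) rfl rfl

theorem contDiffAt_dx (h : ContDiffAt ℝ 2 (fun q : ℝ × ℝ => f q.1 q.2) (x, t)) :
    ContDiffAt ℝ 1 (fun q : ℝ × ℝ => dx f q.1 q.2) (x, t) := by
  have h1 : ContDiffAt ℝ 1 (fderiv ℝ (fun q : ℝ × ℝ => f q.1 q.2)) (x, t) :=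
    h.fderiv_right (by norm_num)
  refine (h1.clm_apply (contDiffAt_const (c := ((1 : ℝ), (0 : ℝ))))).congr_of_eventuallyEq ?_
  filter_upwards [h.eventually (by simp)] with q hq
  rw [(hasFDerivAt_partials (x := q.1) (t := q.2) hq).fderiv]
  simp

/-- A continuous branch of a level set with non-vanishing `x`-derivative is differentiable. -/
theorem hasDerivWithinAt_of_level {X : ℝ → ℝ} {s : Set ℝ} {A B : ℝ}
    (hf : HasFDerivAt (fun q : ℝ × ℝ => f q.1 q.2)
      (A • ContinuousLinearMap.fst ℝ ℝ ℝ + B • ContinuousLinearMap.snd ℝ ℝ ℝ) (X t, t))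
    (hA : A ≠ 0) (hX : ContinuousWithinAt X s t) (hlev : ∀ r ∈ s, f (X r) r = 0)
    (ht : f (X t) t = 0) : HasDerivWithinAt X (-B / A) s t := by
  rw [hasDerivWithinAt_iff_isLittleO, Asymptotics.isLittleO_iff]
  intro c hc
  rw [hasFDerivAt_iff_isLittleO] at hf
  have htend : Tendsto (fun r => (X r, r)) (𝓝[s] t) (𝓝 (X t, t)) :=
    hX.prodMk_nhds (tendsto_id.mono_left nhdsWithin_le_nhds)
  have h2 := hf.comp_tendsto htend
  rw [Asymptotics.isLittleO_iff] at h2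
  set K : ℝ := 1 + |B / A|
  have hK : 1 ≤ K := by simp [K]
  have hA' : 0 < |A| := abs_pos.2 hA
  -- The error is e·max(|D|, |d|), which still contains the increment D to be estimated: e ≤ 1/2
  -- lets its part be absorbed on the left, and 2eK ≤ c controls the rest.
  obtain ⟨e, he, he1, he2⟩ : ∃ e : ℝ, 0 < e ∧ e ≤ 1 / 2 ∧ 2 * e * K ≤ c := by
    refine ⟨min (1 / 2) (c / (2 * K)), by positivity, min_le_left _ _, ?_⟩
    have : min (1 / 2) (c / (2 * K)) ≤ c / (2 * K) := min_le_right _ _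
    rw [le_div_iff₀ (by positivity)] at this
    linarith
  filter_upwards [h2 (c := e * |A|) (by positivity), self_mem_nhdsWithin] with r hr hrs
  have hz := hlev r hrs
  simp only [Function.comp, hz, ht, Prod.mk_sub_mk, add_apply,
    smul_apply, ContinuousLinearMap.coe_fst', ContinuousLinearMap.coe_snd',
    smul_eq_mul, Prod.norm_def, Real.norm_eq_abs] at hr
  set D := X r - X t
  set d := r - t
  have key : |D + B / A * d| ≤ e * max |D| |d| := by
    have : 0 - 0 - (A * D + B * d) = -(A * (D + B / A * d)) := by field_simp; ring
    rw [this, abs_neg, abs_mul] at hr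
    have h3 : |A| * |D + B / A * d| ≤ |A| * (e * max |D| |d|) := by linarith
    exact le_of_mul_le_mul_left h3 hA'
  have hD : |D| ≤ |D + B / A * d| + |B / A| * |d| := by
    have : D = (D + B / A * d) - B / A * d := by ring
    calc |D| = |(D + B / A * d) - B / A * d| := by rw [← this]
      _ ≤ _ := by rw [← abs_mul]; exact abs_sub _ _
  have hmax : max |D| |d| ≤ |D + B / A * d| + K * |d| := by
    have h0 := abs_nonneg d
    have h1 := abs_nonneg (D + B / A * d)
    have h4 := abs_nonneg (B / A)
    apply max_le
    · simp only [K]; nlinarith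
    · simp only [K]; nlinarith
  have hgoal : D - d • (-B / A) = D + B / A * d := by simp only [smul_eq_mul]; ring
  rw [hgoal, Real.norm_eq_abs, Real.norm_eq_abs]
  have h0 := abs_nonneg d
  have h1 := abs_nonneg (D + B / A * d)
  nlinarith [mul_le_mul_of_nonneg_left hmax he.le, mul_le_mul_of_nonneg_right he2 h0]

end Calculus

/-! ### Hyperbolicity up to the shoreline and the motion of the shoreline. -/

section Flow

variable {T : EReal} {η u : ℝ → ℝ → ℝ} {x₀ : ℝ → ℝ} {x t : ℝ}

theorem times_mono {r : ℝ} (ht : t ∈ times T) (h0 : 0 ≤ r) (hr : r ≤ t) : r ∈ times T :=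
  ⟨h0, lt_of_le_of_lt (by exact_mod_cast hr) ht.2⟩

theorem ordConnected_times : (times T).OrdConnected :=
  ⟨fun _ ha _ hb _ hc => times_mono hb (ha.1.trans hc.1) hc.2⟩

theorem times_mem_nhdsWithin (ht : t ∈ times T) : times T ∈ 𝓝[Ici 0] t := by
  have h : {r : ℝ | (r : EReal) < T} ∈ 𝓝 t :=
    (isOpen_lt (continuous_coe_real_ereal) continuous_const).mem_nhds ht.2
  filter_upwards [self_mem_nhdsWithin, mem_nhdsWithin_of_mem_nhds h] with r h1 h2
  exact ⟨h1, h2⟩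

theorem depth_eq_add (η : ℝ → ℝ → ℝ) (x t : ℝ) : depth η x t = x + η x t := rfl

namespace IsFlow

theorem depth_nonneg (hflow : IsFlow T η u x₀)
    (ht : t ∈ times T) (hx : x₀ t ≤ x) : 0 ≤ depth η x t := by
  rcases hx.eq_or_lt with rfl | h
  · exact (hflow.shore_eq t ht).ge
  · exact (hflow.depth_pos t ht x h).le

theorem contDiffAt_η (hflow : IsFlow T η u x₀) (ht : t ∈ times T) (hx : x₀ t ≤ x) :
    ContDiffAt ℝ 2 (fun q : ℝ × ℝ => η q.1 q.2) (x, t) := hflow.smooth_η (x, t) ⟨ht, hx⟩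

theorem contDiffAt_u (hflow : IsFlow T η u x₀) (ht : t ∈ times T) (hx : x₀ t ≤ x) :
    ContDiffAt ℝ 2 (fun q : ℝ × ℝ => u q.1 q.2) (x, t) := hflow.smooth_u (x, t) ⟨ht, hx⟩

theorem dt_η_eq (hflow : IsFlow T η u x₀) (ht : t ∈ times T) (hx : x₀ t ≤ x) :
    dt η x t = -(u x t * (1 + dx η x t) + depth η x t * dx u x t) := by
  have h := hflow.continuity_eq (x, t) ⟨ht, hx⟩
  have hη := hasDerivAt_dx (hflow.contDiffAt_η ht hx)
  have hu := hasDerivAt_dx (hflow.contDiffAt_u ht hx)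
  have h2 := ((hasDerivAt_id x).add hη).mul hu
  have h3 : dx (fun x t => (x + η x t) * u x t) x t
      = (1 + dx η x t) * u x t + (x + η x t) * dx u x t := h2.deriv
  simp only [h3] at h
  rw [depth_eq_add]
  linarith

theorem dt_u_eq (hflow : IsFlow T η u x₀) (ht : t ∈ times T) (hx : x₀ t ≤ x) :
    dt u x t = -(u x t * dx u x t) - dx η x t := by
  have h := hflow.momentum_eq (x, t) ⟨ht, hx⟩
  simp only at h
  linarith

theorem hasDerivAt_depth (hflow : IsFlow T η u x₀) (ht : t ∈ times T) (hx : x₀ t ≤ x) :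
    HasDerivAt (fun y => depth η y t) (1 + dx η x t) x :=
  (hasDerivAt_id x).add (hasDerivAt_dx (hflow.contDiffAt_η ht hx))

theorem dt_depth (hflow : IsFlow T η u x₀) (ht : t ∈ times T) (hx : x₀ t ≤ x) :
    HasDerivAt (fun r => depth η x r) (dt η x t) t :=
  (hasDerivAt_dt (hflow.contDiffAt_η ht hx)).const_add x

theorem hasDerivAt_cgτ (hflow : IsFlow T η u x₀) (ht : t ∈ times T) (hx : x₀ t ≤ x) :
    HasDerivAt (fun y => cgτ u y t) (-dx u x t / 2) x := by
  have := ((hasDerivAt_dx (hflow.contDiffAt_u ht hx)).const_sub t).div_const 2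
  exact this

theorem dt_cgτ (hflow : IsFlow T η u x₀) (ht : t ∈ times T) (hx : x₀ t ≤ x) :
    HasDerivAt (fun r => cgτ u x r) ((1 - dt u x t) / 2) t :=
  ((hasDerivAt_id t).sub (hasDerivAt_dt (hflow.contDiffAt_u ht hx))).div_const 2

/-- Zero depth removes the u_x term of the continuity equation and the determinant becomes a perfect
square, so the shoreline condition says that 1 + η_x ≠ 0. -/
theorem jac_depth_shore (hflow : IsFlow T η u x₀) (ht : t ∈ times T) :
    jac (depth η) (cgτ u) (x₀ t) t = (1 + dx η (x₀ t) t) ^ 2 / 2 := by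
  have e1 : dx (depth η) (x₀ t) t = _ := (hflow.hasDerivAt_depth ht le_rfl).deriv
  have e2 : dt (depth η) (x₀ t) t = _ := (hflow.dt_depth ht le_rfl).deriv
  have e3 : dx (cgτ u) (x₀ t) t = _ := (hflow.hasDerivAt_cgτ ht le_rfl).deriv
  have e4 : dt (cgτ u) (x₀ t) t = _ := (hflow.dt_cgτ ht le_rfl).deriv
  rw [jac, e1, e2, e3, e4, hflow.dt_η_eq ht le_rfl, hflow.dt_u_eq ht le_rfl, hflow.shore_eq t ht]
  ring

/-- The numerator is the product of (1 + η_x) ± σu_x, which are the x-slopes of the two Riemann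
invariants up to sign and the factor 2σ. -/
theorem jac_cgσ (hflow : IsFlow T η u x₀) (ht : t ∈ times T) (hx : x₀ t < x) :
    jac (cgσ η) (cgτ u) x t
      = ((1 + dx η x t) ^ 2 - depth η x t * dx u x t ^ 2) / (4 * √(depth η x t)) := by
  have hpos := hflow.depth_pos t ht x hx
  have e1 : dx (cgσ η) x t = _ := ((hflow.hasDerivAt_depth ht hx.le).sqrt hpos.ne').deriv
  have e2 : dt (cgσ η) x t = _ := ((hflow.dt_depth ht hx.le).sqrt hpos.ne').deriv
  have e3 : dx (cgτ u) x t = _ := (hflow.hasDerivAt_cgτ ht hx.le).deriv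
  have e4 : dt (cgτ u) x t = _ := (hflow.dt_cgτ ht hx.le).deriv
  rw [jac, e1, e2, e3, e4, hflow.dt_η_eq ht hx.le, hflow.dt_u_eq ht hx.le]
  have := Real.sqrt_pos.2 hpos
  field_simp
  ring

/-- The Jacobian excludes zero; the sign comes from difference quotients of the depth, which is zero
at the shoreline and positive beyond it. -/
theorem shore_slope_pos (hflow : IsFlow T η u x₀) (hbreak : NoBreaking T η u x₀)
    (ht : t ∈ times T) : 0 < 1 + dx η (x₀ t) t := by
  have h := hbreak.shore t ht
  rw [hflow.jac_depth_shore ht] at h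
  refine lt_of_le_of_ne ?_ (fun h0 => h (by rw [← h0]; norm_num))
  have hd := (hflow.hasDerivAt_depth ht le_rfl).hasDerivWithinAt (s := Ioi (x₀ t))
  rw [hasDerivWithinAt_iff_tendsto_slope' (by simp)] at hd
  refine ge_of_tendsto hd ?_
  filter_upwards [self_mem_nhdsWithin] with y hy
  rw [slope_def_field, hflow.shore_eq t ht]
  have h1 := hflow.depth_pos t ht y hy
  have h2 : 0 < y - x₀ t := sub_pos.2 hy
  positivity

/-- Hyperbolicity is kept up to the shoreline: the depth increases in `x`, and both Riemann
invariants are strictly monotone in `x`. -/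
theorem slope_pos (hflow : IsFlow T η u x₀) (hbreak : NoBreaking T η u x₀)
    (ht : t ∈ times T) (hx : x₀ t ≤ x) :
    √(depth η x t) * |dx u x t| < 1 + dx η x t := by
  have hcη : ∀ y, x₀ t ≤ y → ContinuousAt (fun y => 1 + dx η y t) y := fun y hy =>
    continuousAt_const.add ((contDiffAt_dx (hflow.contDiffAt_η ht hy)).continuousAt.comp
      (f := fun y : ℝ => (y, t)) (by fun_prop))
  have hcu : ∀ y, x₀ t ≤ y → ContinuousAt (fun y => dx u y t) y := fun y hy =>
    (contDiffAt_dx (hflow.contDiffAt_u ht hy)).continuousAt.comp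
      (f := fun y : ℝ => (y, t)) (by fun_prop)
  by_contra hcon
  push Not at hcon
  have hcont : ContinuousOn
      (fun y => 1 + dx η y t - √(depth η y t) * |dx u y t|) (Icc (x₀ t) x) := fun y hy =>
    ((hcη y hy.1).sub (((hflow.hasDerivAt_depth ht hy.1).continuousAt.sqrt).mul
      (hcu y hy.1).abs)).continuousWithinAt
  have h0 := hflow.shore_slope_pos hbreak ht
  have hmem : (0 : ℝ) ∈ Icc (1 + dx η x t - √(depth η x t) * |dx u x t|)
      (1 + dx η (x₀ t) t - √(depth η (x₀ t) t) * |dx u (x₀ t) t|) := by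
    rw [hflow.shore_eq t ht]
    constructor
    · linarith
    · simpa using h0.le
  -- The difference 1 + η_x - σ|u_x| is positive at the shoreline, where σ = 0; a zero further out
  -- would annihilate the Jacobian.
  obtain ⟨y, hy, hy0⟩ := intermediate_value_Icc' hx hcont hmem
  simp only at hy0
  rcases hy.1.eq_or_lt with h | h
  · rw [← h, hflow.shore_eq t ht] at hy0
    simp at hy0
    linarith
  · refine hbreak.interior t ht y h ?_
    have hpos := hflow.depth_pos t ht y h
    have : 1 + dx η y t = √(depth η y t) * |dx u y t| := by linarith
    rw [hflow.jac_cgσ ht h, this, mul_pow, sq_abs, Real.sq_sqrt hpos.le]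
    simp

theorem one_add_dx_pos (hflow : IsFlow T η u x₀) (hbreak : NoBreaking T η u x₀)
    (ht : t ∈ times T) (hx : x₀ t ≤ x) : 0 < 1 + dx η x t :=
  lt_of_le_of_lt (by positivity) (hflow.slope_pos hbreak ht hx)

theorem strictMonoOn_depth (hflow : IsFlow T η u x₀) (hbreak : NoBreaking T η u x₀)
    (ht : t ∈ times T) :
    StrictMonoOn (fun x => depth η x t) (Ici (x₀ t)) := by
  refine strictMonoOn_of_deriv_pos (convex_Ici _)
    (fun y hy => (hflow.hasDerivAt_depth ht hy).continuousAt.continuousWithinAt) fun y hy => ?_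
  rw [interior_Ici] at hy
  rw [(hflow.hasDerivAt_depth ht (le_of_lt hy)).deriv]
  exact hflow.one_add_dx_pos hbreak ht (le_of_lt hy)

/-- The shoreline is a continuous branch of the zero level of the depth, so its slope is -η_t/(1 +
η_x), and at zero depth η_t = -u(1 + η_x). -/
theorem hasDerivWithinAt_shore (hflow : IsFlow T η u x₀) (hbreak : NoBreaking T η u x₀)
    (ht : t ∈ times T) :
    HasDerivWithinAt x₀ (u (x₀ t) t) (Ici 0) t := by
  have hA := (hflow.shore_slope_pos hbreak ht).ne'
  have hf : HasFDerivAt (fun q : ℝ × ℝ => depth η q.1 q.2)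
      ((1 + dx η (x₀ t) t) • ContinuousLinearMap.fst ℝ ℝ ℝ
        + dt η (x₀ t) t • ContinuousLinearMap.snd ℝ ℝ ℝ) (x₀ t, t) := by
    refine ((hasFDerivAt_fst (p := (x₀ t, t))).add
      (hasFDerivAt_partials (hflow.contDiffAt_η ht le_rfl))).congr_fderiv ?_
    ext <;> simp
  have h := hasDerivWithinAt_of_level hf hA (hflow.shore_cont t ht) hflow.shore_eq
    (hflow.shore_eq t ht)
  rw [hflow.dt_η_eq ht le_rfl, hflow.shore_eq t ht] at h
  have h2 : -(-(u (x₀ t) t * (1 + dx η (x₀ t) t) + 0 * dx u (x₀ t) t)) / (1 + dx η (x₀ t) t)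
      = u (x₀ t) t := by field_simp; ring
  rw [h2] at h
  exact h.mono_of_mem_nhdsWithin (times_mem_nhdsWithin ht)

theorem shoreVel_eq (hflow : IsFlow T η u x₀) (hbreak : NoBreaking T η u x₀)
    (ht : t ∈ times T) : shoreVel x₀ t = u (x₀ t) t :=
  (hflow.hasDerivWithinAt_shore hbreak ht).derivWithin (uniqueDiffOn_Ici 0 t ht.1)

theorem shoreτ_eq (hflow : IsFlow T η u x₀) (hbreak : NoBreaking T η u x₀)
    (ht : t ∈ times T) : shoreτ x₀ t = cgτ u (x₀ t) t := by
  rw [shoreτ, cgτ, hflow.shoreVel_eq hbreak ht]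

/-- The shoreline is a particle path, and the momentum equation gives Dτ/Dt = (1 - Du/Dt)/2 = (1 +
η_x)/2 along such paths. -/
theorem hasDerivWithinAt_cgτ_shore (hflow : IsFlow T η u x₀) (hbreak : NoBreaking T η u x₀)
    (ht : t ∈ times T) :
    HasDerivWithinAt (fun r => cgτ u (x₀ r) r) ((1 + dx η (x₀ t) t) / 2) (Ici 0) t := by
  have h := hasDerivWithinAt_along (hflow.contDiffAt_u ht le_rfl)
    (hflow.hasDerivWithinAt_shore hbreak ht) (hasDerivWithinAt_id t (Ici 0)) rfl rfl
  have h2 := ((hasDerivWithinAt_id t (Ici 0)).sub h).div_const 2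
  refine h2.congr_deriv ?_
  rw [hflow.dt_u_eq ht le_rfl]
  ring

theorem continuousOn_shoreτ (hflow : IsFlow T η u x₀) (hbreak : NoBreaking T η u x₀)
    : ContinuousOn (shoreτ x₀) (times T) := by
  have h : ContinuousOn (fun r => cgτ u (x₀ r) r) (times T) := fun t ht =>
    (hflow.hasDerivWithinAt_cgτ_shore hbreak ht).continuousWithinAt.mono fun r hr => hr.1
  exact h.congr fun t ht => hflow.shoreτ_eq hbreak ht

theorem strictMonoOn_shoreτ (hflow : IsFlow T η u x₀) (hbreak : NoBreaking T η u x₀)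
    : StrictMonoOn (shoreτ x₀) (times T) := by
  refine strictMonoOn_of_deriv_pos (ordConnected_times.convex)
    (hflow.continuousOn_shoreτ hbreak) fun t ht => ?_
  have ht' := interior_subset ht
  have h1 : shoreτ x₀ =ᶠ[𝓝 t] fun r => cgτ u (x₀ r) r := by
    filter_upwards [mem_interior_iff_mem_nhds.1 ht] with r hr using hflow.shoreτ_eq hbreak hr
  have h2 : Ici (0 : ℝ) ∈ 𝓝 t :=
    mem_of_superset (mem_interior_iff_mem_nhds.1 ht) fun r hr => hr.1
  rw [h1.deriv_eq, ((hflow.hasDerivWithinAt_cgτ_shore hbreak ht').hasDerivAt h2).deriv]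
  linarith [hflow.shore_slope_pos hbreak ht']

theorem ordConnected_observed (hflow : IsFlow T η u x₀) (hbreak : NoBreaking T η u x₀)
    : (observed T x₀).OrdConnected := by
  have h : IsPreconnected (times T) := ordConnected_times.isPreconnected
  exact (h.image _ (hflow.continuousOn_shoreτ hbreak)).ordConnected

theorem shoreΨ_shoreτ (hflow : IsFlow T η u x₀) (hbreak : NoBreaking T η u x₀) (ht : t ∈ times T) :
    shoreΨ T x₀ (shoreτ x₀ t) = -x₀ t + shoreVel x₀ t ^ 2 / 2 := by
  rw [shoreΨ, (hflow.strictMonoOn_shoreτ hbreak).injOn.leftInvOn_invFunOn ht]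

end IsFlow

end Flow

/-! ### Riemann invariants and the characteristic that reaches the shoreline at a given time. -/

namespace IsFlow

variable {T : EReal} {η u : ℝ → ℝ → ℝ} {x₀ : ℝ → ℝ} {x t : ℝ}

theorem hasDerivAt_cgτ_along (hflow : IsFlow T η u x₀) (ht : t ∈ times T) (hx : x₀ t ≤ x)
    {X Y : ℝ → ℝ} {X' Y' r : ℝ} (hX : HasDerivAt X X' r)
    (hY : HasDerivAt Y Y' r) (hxr : X r = x) (htr : Y r = t) :
    HasDerivAt (fun r => cgτ u (X r) (Y r))
      ((-dx u x t * X' + (1 + dx η x t + u x t * dx u x t) * Y') / 2) r := by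
  have h := (hY.sub (hasDerivAt_along (hflow.contDiffAt_u ht hx) hX hY hxr htr)).div_const 2
  refine h.congr_deriv ?_
  rw [hflow.dt_u_eq ht hx]
  ring

theorem hasDerivAt_depth_along (hflow : IsFlow T η u x₀) (ht : t ∈ times T) (hx : x₀ t ≤ x)
    {X Y : ℝ → ℝ} {X' Y' r : ℝ} (hX : HasDerivAt X X' r)
    (hY : HasDerivAt Y Y' r) (hxr : X r = x) (htr : Y r = t) :
    HasDerivAt (fun r => depth η (X r) (Y r))
      ((1 + dx η x t) * X' - (u x t * (1 + dx η x t) + depth η x t * dx u x t) * Y') r := by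
  have h := hX.add (hasDerivAt_along (hflow.contDiffAt_η ht hx) hX hY hxr htr)
  refine h.congr_deriv ?_
  rw [hflow.dt_η_eq ht hx]
  ring

theorem continuousAt_u (hflow : IsFlow T η u x₀) (ht : t ∈ times T) (hx : x₀ t ≤ x) :
    ContinuousAt (fun q : ℝ × ℝ => u q.1 q.2) (x, t) := (hflow.contDiffAt_u ht hx).continuousAt

theorem continuousAt_cgτ (hflow : IsFlow T η u x₀) (ht : t ∈ times T) (hx : x₀ t ≤ x) :
    ContinuousAt (fun q : ℝ × ℝ => cgτ u q.1 q.2) (x, t) :=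
  (continuousAt_snd.sub (hflow.continuousAt_u ht hx)).div_const 2

theorem continuousAt_depth (hflow : IsFlow T η u x₀) (ht : t ∈ times T) (hx : x₀ t ≤ x) :
    ContinuousAt (fun q : ℝ × ℝ => depth η q.1 q.2) (x, t) :=
  continuousAt_fst.add (hflow.contDiffAt_η ht hx).continuousAt

theorem shore_continuousOn_Icc (hflow : IsFlow T η u x₀)
    (ht : t ∈ times T) : ContinuousOn x₀ (Icc 0 t) :=
  hflow.shore_cont.mono fun _ hr => times_mono ht hr.1 hr.2

theorem isCompact_wet_slab (hflow : IsFlow T η u x₀) (ht : t ∈ times T) (y : ℝ) :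
    IsCompact {p : ℝ × ℝ | p.2 ∈ Icc 0 t ∧ x₀ p.2 ≤ p.1 ∧ p.1 ≤ y} := by
  have hc := hflow.shore_continuousOn_Icc ht
  obtain ⟨m, hm⟩ := (isCompact_Icc.image_of_continuousOn hc).bddBelow
  have hbox : IsCompact (Icc m y ×ˢ Icc 0 t) := isCompact_Icc.prod isCompact_Icc
  have hcl : IsClosed ((Icc m y ×ˢ Icc 0 t) ∩ (fun p : ℝ × ℝ => p.1 - x₀ p.2) ⁻¹' Ici 0) := by
    refine ContinuousOn.preimage_isClosed_of_isClosed ?_ hbox.isClosed isClosed_Ici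
    exact continuousOn_fst.sub (hc.comp continuousOn_snd fun p hp => hp.2)
  convert hbox.of_isClosed_subset hcl inter_subset_left using 1
  ext p
  simp only [mem_ofPred_eq, mem_inter_iff, mem_prod, mem_preimage, mem_Ici, sub_nonneg]
  constructor
  · rintro ⟨h1, h2, h3⟩
    exact ⟨⟨⟨(hm (mem_image_of_mem _ h1)).trans h2, h3⟩, h1⟩, h2⟩
  · rintro ⟨⟨h1, h2⟩, h3⟩
    exact ⟨h2, h3, h1.2⟩

theorem cgσ_shore (hflow : IsFlow T η u x₀) (ht : t ∈ times T) : cgσ η (x₀ t) t = 0 := by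
  rw [cgσ, hflow.shore_eq t ht, Real.sqrt_zero]

theorem continuousAt_shore (hflow : IsFlow T η u x₀) (hbreak : NoBreaking T η u x₀)
    (ht : t ∈ times T) (h0 : 0 < t) : ContinuousAt x₀ t :=
  ((hflow.hasDerivWithinAt_shore hbreak ht).hasDerivAt (Ici_mem_nhds h0)).continuousAt

theorem shoreτ_zero (hflow : IsFlow T η u x₀) (hbreak : NoBreaking T η u x₀)
    (hT : 0 < T) (hu₀ : ∀ x, x₀ 0 ≤ x → u x 0 = 0) : shoreτ x₀ 0 = 0 := by
  rw [hflow.shoreτ_eq hbreak ⟨le_rfl, hT⟩, cgτ, hu₀ _ le_rfl]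
  simp

theorem shoreτ_nonneg (hflow : IsFlow T η u x₀) (hbreak : NoBreaking T η u x₀)
    (hT : 0 < T) (hu₀ : ∀ x, x₀ 0 ≤ x → u x 0 = 0) (ht : t ∈ times T) :
    0 ≤ shoreτ x₀ t := by
  rw [← hflow.shoreτ_zero hbreak hT hu₀]
  exact (hflow.strictMonoOn_shoreτ hbreak).monotoneOn ⟨le_rfl, hT⟩ ht ht.1

/-- The delayed time increases along particle paths, so that it is nowhere negative. -/
theorem cgτ_nonneg (hflow : IsFlow T η u x₀) (hbreak : NoBreaking T η u x₀)
    (hT : 0 < T) (hu₀ : ∀ x, x₀ 0 ≤ x → u x 0 = 0) (ht : t ∈ times T)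
    (hx : x₀ t ≤ x) : 0 ≤ cgτ u x t := by
  by_contra hneg
  push Not at hneg
  -- Minimum principle on a compact slab cut off at x: a negative minimum of τ lies neither at t = 0
  -- nor on the shoreline.
  obtain ⟨⟨y, r⟩, ⟨hr, hy, hyx⟩, hmin⟩ := (hflow.isCompact_wet_slab ht x).exists_isMinOn
    ⟨(x, t), ⟨ht.1, le_rfl⟩, hx, le_rfl⟩
    (f := fun q : ℝ × ℝ => cgτ u q.1 q.2) (fun p hp =>
      (hflow.continuousAt_cgτ (times_mono ht hp.1.1 hp.1.2) hp.2.1).continuousWithinAt)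
  simp only at hr hy hyx
  have hrT := times_mono ht hr.1 hr.2
  have hlt : cgτ u y r < 0 :=
    lt_of_le_of_lt (hmin (show (x, t) ∈ _ from ⟨⟨ht.1, le_rfl⟩, hx, le_rfl⟩)) hneg
  have hr0 : 0 < r := by
    rcases hr.1.eq_or_lt with h | h
    · subst h
      rw [cgτ, hu₀ _ hy] at hlt
      simp at hlt
    · exact h
  have hy0 : x₀ r < y := by
    rcases hy.eq_or_lt with h | h
    · subst h
      rw [← hflow.shoreτ_eq hbreak hrT] at hlt
      exact absurd (hflow.shoreτ_nonneg hbreak hT hu₀ hrT) (not_le.2 hlt)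
    · exact h
  -- Since u = t - 2τ, negative τ forces u > 0. The backward tangent of the particle path then moves
  -- left and stays in the slab, although τ decreases along it.
  have hu : 0 < u y r := by rw [cgτ] at hlt; linarith
  have hX : HasDerivAt (fun e : ℝ => y - u y r * e) (-u y r) 0 := by
    simpa using ((hasDerivAt_id (0 : ℝ)).const_mul (u y r)).const_sub y
  have hY : HasDerivAt (fun e : ℝ => r - e) (-1) 0 := by
    simpa using (hasDerivAt_id (0 : ℝ)).const_sub r
  have hk := hflow.hasDerivAt_cgτ_along hrT hy hX hY (by simp) (by simp)
  have hk' := hk.hasDerivWithinAt (s := Ioi 0)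
  rw [hasDerivWithinAt_iff_tendsto_slope' (by simp)] at hk'
  have hshore : ∀ᶠ e in 𝓝 (0 : ℝ), x₀ (r - e) < y - u y r * e := by
    have hc1 : ContinuousAt (fun e => x₀ (r - e)) 0 :=
      ContinuousAt.comp (f := fun e => r - e) (by
        simpa using hflow.continuousAt_shore hbreak hrT hr0) (by fun_prop)
    exact hc1.eventually_lt hX.continuousAt (by simpa using hy0)
  have h0 := ge_of_tendsto hk' (b := 0) (by
    filter_upwards [self_mem_nhdsWithin, mem_nhdsWithin_of_mem_nhds hshore,
      mem_nhdsWithin_of_mem_nhds (Iio_mem_nhds hr0)] with e he he1 he2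
    have he : (0 : ℝ) < e := he
    have he2 : e < r := he2
    rw [slope_def_field]
    have hm := hmin (show (y - u y r * e, r - e) ∈ _ from
      ⟨⟨by simp only; linarith, by simp only; linarith [hr.2]⟩, he1.le, by
        simp only; nlinarith⟩)
    simp only [mem_ofPred_eq] at hm
    simp only [mul_zero, sub_zero]
    exact div_nonneg (sub_nonneg.2 hm) he.le)
  have := hflow.one_add_dx_pos hbreak hrT hy
  nlinarith

/-- The derivative is (1 + η_x - σu_x)/(2σ), positive by `slope_pos`. -/
theorem strictMonoOn_invariant_add (hflow : IsFlow T η u x₀) (hbreak : NoBreaking T η u x₀)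
    (ht : t ∈ times T) :
    StrictMonoOn (fun x => cgτ u x t + cgσ η x t) (Ici (x₀ t)) := by
  refine strictMonoOn_of_deriv_pos (convex_Ici _) (fun y hy =>
    ((hflow.hasDerivAt_cgτ ht hy).continuousAt.add
      (hflow.hasDerivAt_depth ht hy).continuousAt.sqrt).continuousWithinAt) fun y hy => ?_
  rw [interior_Ici] at hy
  have hp := hflow.depth_pos t ht y hy
  have hd := (hflow.hasDerivAt_cgτ ht (le_of_lt hy)).add
    ((hflow.hasDerivAt_depth ht (le_of_lt hy)).sqrt hp.ne')
  have hs := hflow.slope_pos hbreak ht (le_of_lt hy)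
  have hσ := Real.sqrt_pos.2 hp
  refine lt_of_lt_of_eq ?_ hd.deriv.symm
  have h3 : -dx u y t / 2 + (1 + dx η y t) / (2 * √(depth η y t))
    = (1 + dx η y t - √(depth η y t) * dx u y t) / (2 * √(depth η y t)) := by field_simp; ring
  rw [h3]
  apply div_pos _ (by positivity)
  nlinarith [le_abs_self (dx u y t)]

theorem strictAntiOn_invariant_sub (hflow : IsFlow T η u x₀) (hbreak : NoBreaking T η u x₀)
    (ht : t ∈ times T) :
    StrictAntiOn (fun x => cgτ u x t - cgσ η x t) (Ici (x₀ t)) := by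
  refine strictAntiOn_of_deriv_neg (convex_Ici _) (fun y hy =>
    ((hflow.hasDerivAt_cgτ ht hy).continuousAt.sub
      (hflow.hasDerivAt_depth ht hy).continuousAt.sqrt).continuousWithinAt) fun y hy => ?_
  rw [interior_Ici] at hy
  have hp := hflow.depth_pos t ht y hy
  have hd := (hflow.hasDerivAt_cgτ ht (le_of_lt hy)).sub
    ((hflow.hasDerivAt_depth ht (le_of_lt hy)).sqrt hp.ne')
  have hs := hflow.slope_pos hbreak ht (le_of_lt hy)
  have hσ := Real.sqrt_pos.2 hp
  refine lt_of_eq_of_lt hd.deriv ?_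
  have h3 : -dx u y t / 2 - (1 + dx η y t) / (2 * √(depth η y t))
    = -((1 + dx η y t + √(depth η y t) * dx u y t) / (2 * √(depth η y t))) := by field_simp; ring
  rw [h3, neg_lt_zero]
  apply div_pos _ (by positivity)
  nlinarith [neg_abs_le (dx u y t)]

/-- The characteristic `τ + σ = S` that ends at the shoreline at time `t₁` has, on `[0, t₁]`,
no point beyond some `L`. -/
theorem exists_invariant_ge (hflow : IsFlow T η u x₀) (hbreak : NoBreaking T η u x₀)
    (hT : 0 < T) (hu₀ : ∀ x, x₀ 0 ≤ x → u x 0 = 0) {t₁ : ℝ}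
    (ht₁ : t₁ ∈ times T) : ∃ L, ∀ t ∈ Icc 0 t₁, x₀ t ≤ L ∧
      ∀ x, L ≤ x → shoreτ x₀ t₁ ≤ cgτ u x t + cgσ η x t := by
  set S := shoreτ x₀ t₁ with hS
  have hS0 : 0 ≤ S := hflow.shoreτ_nonneg hbreak hT hu₀ ht₁
  have hmem : ∀ t ∈ Icc 0 t₁, t ∈ times T := fun t ht => times_mono ht₁ ht.1 ht.2
  -- Here u = t - 2θ ≥ -2S on the shoreline up to t₁, so going back in time the shoreline advances
  -- at speed at most 2S.
  have hmono : MonotoneOn (fun t => x₀ t + 2 * S * t) (Icc 0 t₁) := by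
    have hd : ∀ t ∈ Icc 0 t₁, HasDerivWithinAt (fun t => x₀ t + 2 * S * t)
        (u (x₀ t) t + 2 * S) (Ici 0) t := fun t ht => by
      exact ((hflow.hasDerivWithinAt_shore hbreak (hmem t ht)).add
        ((hasDerivWithinAt_id t (Ici 0)).const_mul (2 * S))).congr_deriv (by ring)
    refine monotoneOn_of_deriv_nonneg (convex_Icc _ _)
      (fun t ht => (hd t ht).continuousWithinAt.mono fun r hr => hr.1) ?_ ?_
    · rw [interior_Icc]
      intro t ht
      exact ((hd t (Ioo_subset_Icc_self ht)).hasDerivAt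
        (Ici_mem_nhds ht.1)).differentiableAt.differentiableWithinAt
    · rw [interior_Icc]
      intro t ht
      have ht' := Ioo_subset_Icc_self ht
      rw [((hd t ht').hasDerivAt (Ici_mem_nhds ht.1)).deriv]
      have h1 : shoreτ x₀ t ≤ S :=
        (hflow.strictMonoOn_shoreτ hbreak).monotoneOn (hmem t ht') ht₁ ht'.2
      rw [hflow.shoreτ_eq hbreak (hmem t ht'), cgτ] at h1
      linarith [ht.1]
  -- A straight line followed backward from t₁, steep enough to outrun both the shoreline and the
  -- characteristic.
  set X : ℝ → ℝ := fun r => x₀ t₁ + 1 + (2 * S + 1) * r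
  have hXshore : ∀ r ∈ Icc 0 t₁, x₀ (t₁ - r) < X r := by
    intro r hr
    have h := hmono (show t₁ - r ∈ Icc 0 t₁ from ⟨by linarith [hr.2], by linarith [hr.1]⟩)
      (show t₁ ∈ Icc 0 t₁ from ⟨ht₁.1, le_rfl⟩) (by linarith [hr.1])
    simp only [X] at h ⊢
    nlinarith [hr.1]
  have hmem' : ∀ r ∈ Icc 0 t₁, t₁ - r ∈ times T := fun r hr =>
    hmem _ ⟨by linarith [hr.2], by linarith [hr.1]⟩
  have hX : ∀ r, HasDerivAt X (2 * S + 1) r := fun r =>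
    (((hasDerivAt_id r).const_mul (2 * S + 1)).const_add (x₀ t₁ + 1)).congr_deriv (by ring)
  have hY : ∀ r, HasDerivAt (fun r : ℝ => t₁ - r) (-1) r := fun r => by
    simpa using (hasDerivAt_id r).const_sub t₁
  set k : ℝ → ℝ := fun r => cgτ u (X r) (t₁ - r) + cgσ η (X r) (t₁ - r) with hkdef
  -- The speed of the line relative to the characteristic dx/dt = u - σ, times the x-slope of τ + σ.
  set k' : ℝ → ℝ := fun r => (2 * S + 1 + u (X r) (t₁ - r) - cgσ η (X r) (t₁ - r))
    * (1 + dx η (X r) (t₁ - r) - cgσ η (X r) (t₁ - r) * dx u (X r) (t₁ - r))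
    / (2 * cgσ η (X r) (t₁ - r)) with hk'
  have hk : ∀ r ∈ Icc 0 t₁, HasDerivAt k (k' r) r := by
    intro r hr
    have hp := hflow.depth_pos _ (hmem' r hr) _ (hXshore r hr)
    have h := (hflow.hasDerivAt_cgτ_along (hmem' r hr) (hXshore r hr).le (hX r) (hY r) rfl rfl).add
      ((hflow.hasDerivAt_depth_along (hmem' r hr) (hXshore r hr).le (hX r) (hY r) rfl rfl).sqrt
        hp.ne')
    refine h.congr_deriv ?_
    have hσ : 0 < √(depth η (X r) (t₁ - r)) := Real.sqrt_pos.2 hp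
    have hsq := Real.sq_sqrt hp.le
    simp only [hk', cgσ]
    set σ := √(depth η (X r) (t₁ - r))
    rw [← hsq]
    field_simp
    ring
  -- Barrier argument: k' > 0 is needed only where k = S. There σ = S - τ, and with u = t - 2τ the
  -- relative speed is S + 1 + t - τ > 0.
  have hle : ∀ r ∈ Icc 0 t₁, S ≤ k r := by
    refine image_le_of_deriv_right_lt_deriv_boundary' (f := fun _ => S) (f' := fun _ => 0)
      (B := k) (B' := k') continuousOn_const (fun r _ => (hasDerivAt_const r S).hasDerivWithinAt)
      ?_ (fun r hr => (hk r hr).continuousAt.continuousWithinAt)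
      (fun r hr => (hk r (Ico_subset_Icc_self hr)).hasDerivWithinAt) ?_
    · have h0 : (0 : ℝ) ∈ Icc 0 t₁ := ⟨le_rfl, ht₁.1⟩
      have h := hXshore 0 h0
      simp only [sub_zero] at h
      have h2 := hflow.strictMonoOn_invariant_add hbreak ht₁ (mem_Ici.2 le_rfl) h.le h
      simp only [hflow.cgσ_shore ht₁, ← hflow.shoreτ_eq hbreak ht₁] at h2
      simp only [hkdef, sub_zero]
      linarith
    · intro r hr hSk
      have hr' := Ico_subset_Icc_self hr
      have hp := hflow.depth_pos _ (hmem' r hr') _ (hXshore r hr')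
      have hσ : 0 < cgσ η (X r) (t₁ - r) := Real.sqrt_pos.2 hp
      have hτ := hflow.cgτ_nonneg hbreak hT hu₀ (hmem' r hr') (hXshore r hr').le
      have hs := hflow.slope_pos hbreak (hmem' r hr') (hXshore r hr').le
      have hu : u (X r) (t₁ - r) = (t₁ - r) - 2 * cgτ u (X r) (t₁ - r) := by rw [cgτ]; ring
      simp only [hkdef] at hSk
      refine div_pos (mul_pos ?_ ?_) (by positivity)
      · rw [hu]
        linarith [hr.2]
      · have : cgσ η (X r) (t₁ - r) * dx u (X r) (t₁ - r)
            ≤ cgσ η (X r) (t₁ - r) * |dx u (X r) (t₁ - r)| :=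
          mul_le_mul_of_nonneg_left (le_abs_self _) hσ.le
        rw [cgσ] at this ⊢
        linarith
  refine ⟨X t₁, fun t ht => ?_⟩
  have hr : t₁ - t ∈ Icc 0 t₁ := ⟨by linarith [ht.2], by linarith [ht.1]⟩
  have h1 := hXshore _ hr
  have h2 := hle _ hr
  have h3 : X (t₁ - t) ≤ X t₁ := by
    simp only [X]
    nlinarith [ht.1]
  simp only [hkdef, sub_sub_cancel] at h1 h2
  refine ⟨by linarith, fun x hx => h2.trans ?_⟩
  exact (hflow.strictMonoOn_invariant_add hbreak (hmem t ht)).monotoneOn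
    h1.le (h1.le.trans (h3.trans hx)) (h3.trans hx)

/-- Both invariants enter: τ - σ ≤ θ(t) ≤ S ≤ τ + σ, that is |S - τ| ≤ σ. -/
theorem sq_sub_depth_nonpos (hflow : IsFlow T η u x₀) (hbreak : NoBreaking T η u x₀)
    {t₁ : ℝ} (ht₁ : t₁ ∈ times T) (ht : t ∈ Icc 0 t₁) (hx : x₀ t ≤ x)
    (hS : shoreτ x₀ t₁ ≤ cgτ u x t + cgσ η x t) :
    (shoreτ x₀ t₁ - cgτ u x t) ^ 2 - depth η x t ≤ 0 := by
  have htT := times_mono ht₁ ht.1 ht.2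
  have h1 := (hflow.strictAntiOn_invariant_sub hbreak htT).antitoneOn (mem_Ici.2 le_rfl) hx hx
  have h2 : shoreτ x₀ t ≤ shoreτ x₀ t₁ :=
    (hflow.strictMonoOn_shoreτ hbreak).monotoneOn htT ht₁ ht.2
  simp only [hflow.cgσ_shore htT, ← hflow.shoreτ_eq hbreak htT] at h1
  have h3 : cgσ η x t ^ 2 = depth η x t := Real.sq_sqrt (hflow.depth_nonneg htT hx)
  rw [← h3, sub_nonpos]
  exact sq_le_sq' (by linarith) (by linarith)

/-- The initial depth takes every value `σ²` with `σ` observed at the shoreline. -/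
theorem exists_depth_eq_sq (hflow : IsFlow T η u x₀) (hbreak : NoBreaking T η u x₀)
    (hT : 0 < T) (hu₀ : ∀ x, x₀ 0 ≤ x → u x 0 = 0) {t₁ : ℝ}
    (ht₁ : t₁ ∈ times T) : ∃ x, x₀ 0 ≤ x ∧ depth η x 0 = shoreτ x₀ t₁ ^ 2 := by
  obtain ⟨L, hL⟩ := hflow.exists_invariant_ge hbreak hT hu₀ ht₁
  have h0 : (0 : ℝ) ∈ times T := ⟨le_rfl, hT⟩
  obtain ⟨h1, h2⟩ := hL 0 ⟨le_rfl, ht₁.1⟩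
  have h3 := hflow.sq_sub_depth_nonpos hbreak ht₁ ⟨le_rfl, ht₁.1⟩ h1 (h2 L le_rfl)
  rw [cgτ, hu₀ L h1] at h3
  have hc : ContinuousOn (fun x => depth η x 0) (Icc (x₀ 0) L) := fun y hy =>
    (hflow.hasDerivAt_depth h0 hy.1).continuousAt.continuousWithinAt
  obtain ⟨x, hx, hx2⟩ := intermediate_value_Icc h1 hc
    (show shoreτ x₀ t₁ ^ 2 ∈ _ from ⟨by rw [hflow.shore_eq 0 h0]; positivity, by
      simp at h3; linarith⟩)
  exact ⟨x, hx.1, hx2⟩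

end IsFlow

/-! ### A C¹ regularization of the square root. -/

section RegularizedSqrt

theorem hasDerivAt_mul_sqrt (y : ℝ) : HasDerivAt (fun y => y * √y) (3 / 2 * √y) y := by
  rcases lt_trichotomy y 0 with h | h | h
  · have h1 : (fun y => y * √y) =ᶠ[𝓝 y] fun _ => 0 := by
      filter_upwards [Iio_mem_nhds h] with z hz
      rw [Real.sqrt_eq_zero_of_nonpos (le_of_lt hz), mul_zero]
    rw [Real.sqrt_eq_zero_of_nonpos h.le, mul_zero]
    exact (hasDerivAt_const y (0 : ℝ)).congr_of_eventuallyEq h1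
  · subst h
    rw [hasDerivAt_iff_tendsto_slope]
    have h1 : Tendsto (fun y : ℝ => √y) (𝓝[≠] 0) (𝓝 (3 / 2 * √0)) := by
      have := Real.continuous_sqrt.tendsto 0
      simpa using this.mono_left nhdsWithin_le_nhds
    refine h1.congr' ?_
    filter_upwards [self_mem_nhdsWithin] with z hz
    have hz : z ≠ 0 := hz
    rw [slope_def_field]
    field_simp
    simp
  · refine ((hasDerivAt_id y).mul ((hasDerivAt_id y).sqrt h.ne')).congr_deriv ?_
    have h2 := Real.sqrt_pos.2 h
    have h3 := Real.sq_sqrt h.le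
    simp only [id]
    field_simp
    rw [h3]
    ring

/-- A continuously differentiable approximation of the square root, zero on the negative axis. -/
noncomputable def regSqrt (ε y : ℝ) : ℝ := y * √y / (y + ε)

/-- The derivative of `regSqrt`. -/
noncomputable def regSqrtDeriv (ε y : ℝ) : ℝ :=
  (3 / 2 * √y * (y + ε) - y * √y) / (y + ε) ^ 2

variable {ε : ℝ}

theorem regSqrt_of_nonpos {y : ℝ} (hy : y ≤ 0) : regSqrt ε y = 0 := by
  rw [regSqrt, Real.sqrt_eq_zero_of_nonpos hy]
  simp

theorem hasDerivAt_regSqrt (hε : 0 < ε) (y : ℝ) :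
    HasDerivAt (regSqrt ε) (regSqrtDeriv ε y) y := by
  rcases lt_or_ge y 0 with h | h
  · have h1 : regSqrt ε =ᶠ[𝓝 y] fun _ => 0 := by
      filter_upwards [Iio_mem_nhds h] with z hz using regSqrt_of_nonpos (le_of_lt hz)
    have h2 : regSqrtDeriv ε y = 0 := by
      rw [regSqrtDeriv, Real.sqrt_eq_zero_of_nonpos h.le]; simp
    rw [h2]
    exact (hasDerivAt_const y (0 : ℝ)).congr_of_eventuallyEq h1
  · refine ((hasDerivAt_mul_sqrt y).div ((hasDerivAt_id y).add_const ε)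
      (by simp only [id]; positivity)).congr_deriv ?_
    rw [regSqrtDeriv]
    simp

theorem continuous_regSqrt (hε : 0 < ε) : Continuous (regSqrt ε) :=
  continuous_iff_continuousAt.2 fun y => (hasDerivAt_regSqrt hε y).continuousAt

theorem mul_sqrt_div_le (hε : 0 < ε) {y : ℝ} (hy : 0 ≤ y) : ε * √y / (y + ε) ≤ √ε / 2 := by
  rw [div_le_div_iff₀ (by positivity) (by norm_num)]
  have h1 := Real.sq_sqrt hε.le
  have h2 := Real.sq_sqrt hy
  rw [show √ε * (y + ε) = √ε * (√y ^ 2 + √ε ^ 2) by rw [h1, h2],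
    show ε * √y * 2 = √ε ^ 2 * √y * 2 by rw [h1]]
  nlinarith [mul_nonneg (Real.sqrt_nonneg ε) (sq_nonneg (√y - √ε))]

theorem abs_sqrt_sub_regSqrt_le (hε : 0 < ε) (y : ℝ) : |√y - regSqrt ε y| ≤ √ε := by
  rcases le_total y 0 with h | h
  · rw [regSqrt_of_nonpos h, Real.sqrt_eq_zero_of_nonpos h]
    simp
  · have h1 : √y - regSqrt ε y = ε * √y / (y + ε) := by
      rw [regSqrt]
      field_simp
      ring
    rw [h1, abs_of_nonneg (by positivity)]
    linarith [mul_sqrt_div_le hε h, Real.sqrt_nonneg ε]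

/-- This is the defect in the conservation law, zero for the exact root. Writing max y 0 in place of
y in the denominator avoids the pole at y = -ε and makes continuity visible. -/
theorem regSqrt_sub_eq (hε : 0 < ε) (y : ℝ) :
    regSqrt ε y - 2 * y * regSqrtDeriv ε y = -(2 * ε * (y * √y / (max y 0 + ε) ^ 2)) := by
  rcases le_total y 0 with h | h
  · rw [regSqrt, regSqrtDeriv, Real.sqrt_eq_zero_of_nonpos h]
    simp
  · rw [regSqrt, regSqrtDeriv, max_eq_left h]
    have : y + ε ≠ 0 := by positivity
    field_simp
    ring

theorem abs_regSqrt_sub_le (hε : 0 < ε) (y : ℝ) :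
    |regSqrt ε y - 2 * y * regSqrtDeriv ε y| ≤ √ε := by
  rw [regSqrt_sub_eq hε, abs_neg]
  rcases le_total y 0 with h | h
  · rw [Real.sqrt_eq_zero_of_nonpos h]
    simp
  · rw [max_eq_left h, abs_of_nonneg (by positivity)]
    have h1 : 2 * ε * (y * √y / (y + ε) ^ 2) = 2 * (ε * √y / (y + ε)) * (y / (y + ε)) := by
      field_simp
    rw [h1]
    have h2 : y / (y + ε) ≤ 1 := by rw [div_le_one (by positivity)]; linarith
    have h3 := mul_sqrt_div_le hε h
    have h4 : 0 ≤ ε * √y / (y + ε) := by positivity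
    nlinarith

theorem continuous_regSqrt_sub (hε : 0 < ε) :
    Continuous fun y => regSqrt ε y - 2 * y * regSqrtDeriv ε y := by
  simp only [regSqrt_sub_eq hε]
  have : ∀ y : ℝ, (max y 0 + ε) ^ 2 ≠ 0 := fun y => by positivity
  fun_prop (disch := exact this _)

end RegularizedSqrt

theorem eq_of_forall_abs_sub_le_mul_sqrt {A B K : ℝ} (h : ∀ ε : ℝ, 0 < ε → |A - B| ≤ K * √ε) :
    A = B := by
  have h1 : Tendsto (fun ε : ℝ => K * √ε) (𝓝[>] 0) (𝓝 0) := by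
    have : Continuous fun ε : ℝ => K * √ε := by fun_prop
    have h2 := (this.tendsto 0).mono_left (nhdsWithin_le_nhds (s := Ioi 0))
    simpa using h2
  have h3 : |A - B| ≤ 0 := ge_of_tendsto h1 (by
    filter_upwards [self_mem_nhdsWithin] with ε hε using h ε hε)
  exact sub_eq_zero.1 (abs_eq_zero.1 (le_antisymm h3 (abs_nonneg _)))

theorem fderiv_apply_one_zero {F : ℝ × ℝ → ℝ} {z t d : ℝ} (hF : DifferentiableAt ℝ F (z, t))
    (h : HasDerivAt (fun y => F (y, t)) d z) : fderiv ℝ F (z, t) (1, 0) = d := by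
  have h1 := HasFDerivAt.comp_hasDerivAt (f := fun y => (y, t)) z hF.hasFDerivAt
      ((hasDerivAt_id z).prodMk (hasDerivAt_const z t))
  exact h1.unique h

theorem fderiv_apply_zero_one {F : ℝ × ℝ → ℝ} {z t d : ℝ} (hF : DifferentiableAt ℝ F (z, t))
    (h : HasDerivAt (fun r => F (z, r)) d t) : fderiv ℝ F (z, t) (0, 1) = d := by
  have h1 := HasFDerivAt.comp_hasDerivAt (f := fun r => (z, r)) t hF.hasFDerivAt
      ((hasDerivAt_const t z).prodMk (hasDerivAt_id t))
  exact h1.unique h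

/-! ### The conservation law and its integral over the region swept by the characteristic. -/

namespace IsFlow

variable {T : EReal} {η u : ℝ → ℝ → ℝ} {x₀ : ℝ → ℝ} {x t : ℝ}

/-- `(S - τ)² - σ²` in the frame of the shoreline, `x = x₀(t) + z`. -/
noncomputable def charQ (η u : ℝ → ℝ → ℝ) (x₀ : ℝ → ℝ) (S : ℝ) (p : ℝ × ℝ) : ℝ :=
  (S - cgτ u (x₀ p.2 + p.1) p.2) ^ 2 - depth η (x₀ p.2 + p.1) p.2

/-- The flux of `√((S - τ)² - σ²)` relative to the shoreline is this velocity times the density. -/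
noncomputable def charVel (u : ℝ → ℝ → ℝ) (x₀ : ℝ → ℝ) (S : ℝ) (p : ℝ × ℝ) : ℝ :=
  u (x₀ p.2 + p.1) p.2 - (S - cgτ u (x₀ p.2 + p.1) p.2) - u (x₀ p.2) p.2

theorem continuousOn_frame (hflow : IsFlow T η u x₀) {t₁ ℓ : ℝ} (ht₁ : t₁ ∈ times T) {g : ℝ → ℝ → ℝ}
    (hg : ∀ t ∈ times T, ∀ x, x₀ t ≤ x → ContinuousAt (fun q : ℝ × ℝ => g q.1 q.2) (x, t)) :
    ContinuousOn (fun p : ℝ × ℝ => g (x₀ p.2 + p.1) p.2) (Icc 0 ℓ ×ˢ Icc 0 t₁) := by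
  have hc := hflow.shore_continuousOn_Icc ht₁
  have hm : ContinuousOn (fun p : ℝ × ℝ => (x₀ p.2 + p.1, p.2)) (Icc 0 ℓ ×ˢ Icc 0 t₁) :=
    ((hc.comp continuousOn_snd fun p hp => hp.2).add continuousOn_fst).prodMk continuousOn_snd
  intro p hp
  exact ContinuousAt.comp_continuousWithinAt (g := fun q : ℝ × ℝ => g q.1 q.2)
    (f := fun p : ℝ × ℝ => (x₀ p.2 + p.1, p.2)) (hg p.2 (times_mono ht₁ hp.2.1 hp.2.2) _ (by linarith [hp.1.1])) (hm p hp)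

theorem continuousOn_charQ (hflow : IsFlow T η u x₀) {t₁ ℓ S : ℝ} (ht₁ : t₁ ∈ times T) :
    ContinuousOn (charQ η u x₀ S) (Icc 0 ℓ ×ˢ Icc 0 t₁) :=
  ((continuousOn_const.sub
    (hflow.continuousOn_frame ht₁ fun _ ht _ hx => hflow.continuousAt_cgτ ht hx)).pow 2).sub
    (hflow.continuousOn_frame ht₁ fun _ ht _ hx => hflow.continuousAt_depth ht hx)

theorem continuousOn_u_shore (hflow : IsFlow T η u x₀) {t₁ : ℝ} (ht₁ : t₁ ∈ times T) :
    ContinuousOn (fun t => u (x₀ t) t) (Icc 0 t₁) := by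
  have hm : ContinuousOn (fun t : ℝ => (x₀ t, t)) (Icc 0 t₁) :=
    (hflow.shore_continuousOn_Icc ht₁).prodMk continuousOn_id
  intro t ht
  exact ContinuousAt.comp_continuousWithinAt (g := fun q : ℝ × ℝ => u q.1 q.2)
    (f := fun t => (x₀ t, t)) (hflow.continuousAt_u (times_mono ht₁ ht.1 ht.2) le_rfl) (hm t ht)

theorem continuousOn_charVel (hflow : IsFlow T η u x₀) {t₁ ℓ S : ℝ} (ht₁ : t₁ ∈ times T) :
    ContinuousOn (charVel u x₀ S) (Icc 0 ℓ ×ˢ Icc 0 t₁) :=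
  ((hflow.continuousOn_frame ht₁ fun _ ht _ hx => hflow.continuousAt_u ht hx).sub
    (continuousOn_const.sub
      (hflow.continuousOn_frame ht₁ fun _ ht _ hx => hflow.continuousAt_cgτ ht hx))).sub
    ((hflow.continuousOn_u_shore ht₁).comp continuousOn_snd fun _ hp => hp.2)

theorem continuousOn_dx_u (hflow : IsFlow T η u x₀) {t₁ ℓ : ℝ} (ht₁ : t₁ ∈ times T) :
    ContinuousOn (fun p : ℝ × ℝ => dx u (x₀ p.2 + p.1) p.2) (Icc 0 ℓ ×ˢ Icc 0 t₁) :=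
  hflow.continuousOn_frame ht₁ fun _ ht _ hx =>
    (contDiffAt_dx (hflow.contDiffAt_u ht hx)).continuousAt

theorem exists_abs_dx_u_le (hflow : IsFlow T η u x₀) {t₁ ℓ : ℝ} (ht₁ : t₁ ∈ times T) :
    ∃ C, 0 ≤ C ∧ ∀ p ∈ Icc 0 ℓ ×ˢ Icc 0 t₁, |dx u (x₀ p.2 + p.1) p.2 / 2| ≤ C := by
  obtain ⟨C, hC⟩ := (isCompact_Icc.prod isCompact_Icc).exists_bound_of_continuousOn
    ((hflow.continuousOn_dx_u (ℓ := ℓ) ht₁).div_const 2)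
  exact ⟨max C 0, le_max_right _ _, fun p hp => (hC p hp).trans (le_max_left _ _)⟩

theorem hasDerivAt_shore (hflow : IsFlow T η u x₀) (hbreak : NoBreaking T η u x₀)
    (ht : t ∈ times T) (h0 : 0 < t) : HasDerivAt x₀ (u (x₀ t) t) t :=
  (hflow.hasDerivWithinAt_shore hbreak ht).hasDerivAt (Ici_mem_nhds h0)

theorem differentiableAt_frame (hflow : IsFlow T η u x₀) (hbreak : NoBreaking T η u x₀)
    {z : ℝ} (ht : t ∈ times T) (h0 : 0 < t) {g : ℝ → ℝ → ℝ}
    (hg : DifferentiableAt ℝ (fun q : ℝ × ℝ => g q.1 q.2) (x₀ t + z, t)) :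
    DifferentiableAt ℝ (fun p : ℝ × ℝ => g (x₀ p.2 + p.1) p.2) (z, t) := by
  have hs : DifferentiableAt ℝ (fun p : ℝ × ℝ => x₀ p.2) (z, t) :=
    DifferentiableAt.comp (z, t) (g := x₀) (f := Prod.snd)
      (hflow.hasDerivAt_shore hbreak ht h0).differentiableAt differentiableAt_snd
  exact DifferentiableAt.comp (z, t) (g := fun q : ℝ × ℝ => g q.1 q.2)
    (f := fun p : ℝ × ℝ => (x₀ p.2 + p.1, p.2)) hg
    ((hs.add differentiableAt_fst).prodMk differentiableAt_snd)

theorem differentiableAt_charQ (hflow : IsFlow T η u x₀) (hbreak : NoBreaking T η u x₀)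
    {z S : ℝ} (ht : t ∈ times T) (h0 : 0 < t) (hz : 0 ≤ z) :
    DifferentiableAt ℝ (charQ η u x₀ S) (z, t) := by
  have hx : x₀ t ≤ x₀ t + z := by linarith
  have h1 := hflow.differentiableAt_frame hbreak ht h0
    ((hflow.contDiffAt_u ht hx).differentiableAt (by norm_num))
  have h2 := hflow.differentiableAt_frame hbreak ht h0
    ((hflow.contDiffAt_η ht hx).differentiableAt (by norm_num))
  have hs : DifferentiableAt ℝ (fun p : ℝ × ℝ => x₀ p.2) (z, t) :=
    DifferentiableAt.comp (z, t) (g := x₀) (f := Prod.snd)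
      (hflow.hasDerivAt_shore hbreak ht h0).differentiableAt differentiableAt_snd
  have h3 : DifferentiableAt ℝ (fun p : ℝ × ℝ => cgτ u (x₀ p.2 + p.1) p.2) (z, t) := by
    simp only [cgτ, div_eq_mul_inv]
    exact (differentiableAt_snd.sub h1).mul_const _
  exact ((h3.const_sub S).pow 2).sub ((hs.add differentiableAt_fst).add h2)

theorem differentiableAt_charVel (hflow : IsFlow T η u x₀) (hbreak : NoBreaking T η u x₀)
    {z S : ℝ} (ht : t ∈ times T) (h0 : 0 < t) (hz : 0 ≤ z) :
    DifferentiableAt ℝ (charVel u x₀ S) (z, t) := by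
  have hx : x₀ t ≤ x₀ t + z := by linarith
  have h1 := hflow.differentiableAt_frame hbreak ht h0
    ((hflow.contDiffAt_u ht hx).differentiableAt (by norm_num))
  have h2 : DifferentiableAt ℝ (fun p : ℝ × ℝ => u (x₀ p.2) p.2) (z, t) :=
    DifferentiableAt.comp (z, t) (g := fun t => u (x₀ t) t) (f := Prod.snd)
      (hasDerivAt_along (hflow.contDiffAt_u ht le_rfl) (hflow.hasDerivAt_shore hbreak ht h0)
        (hasDerivAt_id t) rfl rfl).differentiableAt differentiableAt_snd
  have h3 : DifferentiableAt ℝ (fun p : ℝ × ℝ => cgτ u (x₀ p.2 + p.1) p.2) (z, t) := by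
    simp only [cgτ, div_eq_mul_inv]
    exact (differentiableAt_snd.sub h1).mul_const _
  exact (h1.sub (h3.const_sub S)).sub h2

/-- The balance law for `f((S - τ)² - σ²)`; the right-hand side vanishes for `f = √`. -/
theorem balance (hflow : IsFlow T η u x₀) (hbreak : NoBreaking T η u x₀)
    {z S : ℝ} {f : ℝ → ℝ} {f' : ℝ} (ht : t ∈ times T) (h0 : 0 < t) (hz : 0 ≤ z)
    (hf : HasDerivAt f f' (charQ η u x₀ S (z, t))) :
    fderiv ℝ (fun p => charVel u x₀ S p * f (charQ η u x₀ S p)) (z, t) (1, 0)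
      + fderiv ℝ (fun p => f (charQ η u x₀ S p)) (z, t) (0, 1)
      = (f (charQ η u x₀ S (z, t)) - 2 * charQ η u x₀ S (z, t) * f')
        * (dx u (x₀ t + z) t / 2) := by
  have hx : x₀ t ≤ x₀ t + z := by linarith
  have hdG : DifferentiableAt ℝ (fun p => f (charQ η u x₀ S p)) (z, t) :=
    DifferentiableAt.comp (z, t) hf.differentiableAt
      (hflow.differentiableAt_charQ hbreak ht h0 hz)
  have hdF : DifferentiableAt ℝ (fun p => charVel u x₀ S p * f (charQ η u x₀ S p)) (z, t) :=
    (hflow.differentiableAt_charVel hbreak (S := S) ht h0 hz).mul hdG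
  have hXz : HasDerivAt (fun y => x₀ t + y) 1 z := (hasDerivAt_id z).const_add _
  have hYz : HasDerivAt (fun _ : ℝ => t) 0 z := hasDerivAt_const z t
  have hXt : HasDerivAt (fun r => x₀ r + z) (u (x₀ t) t) t :=
    (hflow.hasDerivAt_shore hbreak ht h0).add_const z
  have hτz := hflow.hasDerivAt_cgτ_along ht hx hXz hYz rfl rfl
  have hHz := hflow.hasDerivAt_depth_along ht hx hXz hYz rfl rfl
  have huz := hasDerivAt_along (hflow.contDiffAt_u ht hx) hXz hYz rfl rfl
  have hτt := hflow.hasDerivAt_cgτ_along ht hx hXt (hasDerivAt_id t) rfl rfl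
  have hHt := hflow.hasDerivAt_depth_along ht hx hXt (hasDerivAt_id t) rfl rfl
  have hQz : HasDerivAt (fun y => charQ η u x₀ S (y, t)) _ z :=
    ((hτz.const_sub S).pow 2).sub hHz
  have hQt : HasDerivAt (fun r => charQ η u x₀ S (z, r)) _ t :=
    ((hτt.const_sub S).pow 2).sub hHt
  have hVz : HasDerivAt (fun y => charVel u x₀ S (y, t)) _ z :=
    (huz.sub (hτz.const_sub S)).sub_const (u (x₀ t) t)
  have hGz : HasDerivAt (fun y => f (charQ η u x₀ S (y, t))) _ z := HasDerivAt.comp z hf hQz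
  have hGt : HasDerivAt (fun r => f (charQ η u x₀ S (z, r))) _ t := HasDerivAt.comp t hf hQt
  rw [fderiv_apply_one_zero hdF (hVz.mul hGz), fderiv_apply_zero_one hdG hGt]
  -- With the value of f hidden, the rest is a polynomial identity in the partial derivatives and
  -- f'.
  generalize f (charQ η u x₀ S (z, t)) = fq
  simp only [charQ, charVel, id]
  ring

/-- The divergence theorem on a rectangle in the shoreline frame. The right and top edges carry
nothing because the regularized root vanishes on nonpositive arguments; on the left edge the
velocity is -(S - τ) and Q = (S - τ)². The source term is at most C√ε. -/
theorem regularized_identity (hflow : IsFlow T η u x₀) (hbreak : NoBreaking T η u x₀)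
    {t₁ ℓ S C ε : ℝ} (ht₁ : t₁ ∈ times T) (hℓ : 0 ≤ ℓ) (hε : 0 < ε)
    (hC0 : 0 ≤ C) (hC : ∀ p ∈ Icc 0 ℓ ×ˢ Icc 0 t₁, |dx u (x₀ p.2 + p.1) p.2 / 2| ≤ C)
    (hright : ∀ t ∈ Icc 0 t₁, charQ η u x₀ S (ℓ, t) ≤ 0)
    (htop : ∀ z ∈ Icc 0 ℓ, charQ η u x₀ S (z, t₁) ≤ 0) :
    |(∫ t in (0 : ℝ)..t₁, (S - cgτ u (x₀ t) t) * regSqrt ε ((S - cgτ u (x₀ t) t) ^ 2))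
      - ∫ z in (0 : ℝ)..ℓ, regSqrt ε (charQ η u x₀ S (z, 0))| ≤ C * √ε * t₁ * ℓ := by
  have h0t := ht₁.1
  set F : ℝ × ℝ → ℝ := fun p => charVel u x₀ S p * regSqrt ε (charQ η u x₀ S p) with hF
  set G : ℝ × ℝ → ℝ := fun p => regSqrt ε (charQ η u x₀ S p) with hG
  set W : ℝ × ℝ → ℝ := fun p => (regSqrt ε (charQ η u x₀ S p)
    - 2 * charQ η u x₀ S p * regSqrtDeriv ε (charQ η u x₀ S p))
      * (dx u (x₀ p.2 + p.1) p.2 / 2) with hW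
  set I : Set (ℝ × ℝ) := Ioo 0 ℓ ×ˢ Ioo 0 t₁ with hI
  have hIsub : I ⊆ Icc 0 ℓ ×ˢ Icc 0 t₁ := prod_mono Ioo_subset_Icc_self Ioo_subset_Icc_self
  have hIT : ∀ p ∈ I, p.2 ∈ times T := fun p hp => times_mono ht₁ hp.2.1.le hp.2.2.le
  classical
  -- Derivatives are controlled only inside: at t = 0 the shoreline has just a one-sided derivative.
  -- Setting them to zero elsewhere makes the divergence an indicator of a continuous function,
  -- hence integrable.
  set F' : ℝ × ℝ → ℝ × ℝ →L[ℝ] ℝ := fun p => if p ∈ I then fderiv ℝ F p else 0 with hF'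
  set G' : ℝ × ℝ → ℝ × ℝ →L[ℝ] ℝ := fun p => if p ∈ I then fderiv ℝ G p else 0 with hG'
  have hdivEq : ∀ p, F' p (1, 0) + G' p (0, 1) = I.indicator W p := by
    intro p
    by_cases hp : p ∈ I
    · simp only [hF', hG', hp, if_true, indicator_of_mem]
      exact hflow.balance hbreak (hIT p hp) hp.2.1 hp.1.1.le (hasDerivAt_regSqrt hε _)
    · simp [hF', hG', hp]
  have hQc := hflow.continuousOn_charQ (S := S) (ℓ := ℓ) ht₁
  have hGc : ContinuousOn G (Icc 0 ℓ ×ˢ Icc 0 t₁) := (continuous_regSqrt hε).comp_continuousOn hQc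
  have hFc : ContinuousOn F (Icc 0 ℓ ×ˢ Icc 0 t₁) := (hflow.continuousOn_charVel ht₁).mul hGc
  have hWc : ContinuousOn W (Icc 0 ℓ ×ˢ Icc 0 t₁) :=
    ((continuous_regSqrt_sub hε).comp_continuousOn hQc).mul
      ((hflow.continuousOn_dx_u ht₁).div_const 2)
  have hWb : ∀ p, |I.indicator W p| ≤ C * √ε := by
    intro p
    by_cases hp : p ∈ I
    · rw [indicator_of_mem hp, hW, abs_mul, mul_comm C]
      exact mul_le_mul (abs_regSqrt_sub_le hε _) (hC p (hIsub hp)) (abs_nonneg _)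
        (Real.sqrt_nonneg _)
    · rw [indicator_of_notMem hp, abs_zero]
      positivity
  have hdG : ∀ p ∈ I, DifferentiableAt ℝ G p := fun p hp =>
    DifferentiableAt.comp p (hasDerivAt_regSqrt hε _).differentiableAt
      (hflow.differentiableAt_charQ hbreak (hIT p hp) hp.2.1 hp.1.1.le)
  have hdF : ∀ p ∈ I, DifferentiableAt ℝ F p := fun p hp =>
    (hflow.differentiableAt_charVel hbreak (hIT p hp) hp.2.1 hp.1.1.le).mul (hdG p hp)
  have hmeasI : MeasurableSet I := measurableSet_Ioo.prod measurableSet_Ioo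
  have hdiv := integral2_divergence_prod_of_hasFDerivAt_off_countable F G F' G' 0 0 ℓ t₁ ∅
    countable_empty (by rwa [uIcc_of_le hℓ, uIcc_of_le h0t])
    (by rwa [uIcc_of_le hℓ, uIcc_of_le h0t])
    (by
      rw [min_eq_left hℓ, min_eq_left h0t, max_eq_right hℓ, max_eq_right h0t, sdiff_empty]
      intro p hp
      simp only [hF', show p ∈ I from hp, if_true]
      exact (hdF p hp).hasFDerivAt)
    (by
      rw [min_eq_left hℓ, min_eq_left h0t, max_eq_right hℓ, max_eq_right h0t, sdiff_empty]
      intro p hp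
      simp only [hG', show p ∈ I from hp, if_true]
      exact (hdG p hp).hasFDerivAt)
    (by
      rw [uIcc_of_le hℓ, uIcc_of_le h0t]
      simp only [hdivEq]
      exact (hWc.integrableOn_compact (isCompact_Icc.prod isCompact_Icc)).indicator hmeasI)
  have e1 : ∫ z in (0 : ℝ)..ℓ, G (z, t₁) = 0 := by
    rw [intervalIntegral.integral_congr (g := fun _ => (0 : ℝ)), intervalIntegral.integral_zero]
    intro z hz
    rw [uIcc_of_le hℓ] at hz
    exact regSqrt_of_nonpos (htop z hz)
  have e2 : ∫ t in (0 : ℝ)..t₁, F (ℓ, t) = 0 := by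
    rw [intervalIntegral.integral_congr (g := fun _ => (0 : ℝ)), intervalIntegral.integral_zero]
    intro t ht
    rw [uIcc_of_le h0t] at ht
    simp only [hF, regSqrt_of_nonpos (hright t ht), mul_zero]
  have e3 : ∫ t in (0 : ℝ)..t₁, F (0, t)
      = -∫ t in (0 : ℝ)..t₁, (S - cgτ u (x₀ t) t) * regSqrt ε ((S - cgτ u (x₀ t) t) ^ 2) := by
    rw [← intervalIntegral.integral_neg]
    refine intervalIntegral.integral_congr fun t ht => ?_
    rw [uIcc_of_le h0t] at ht
    have hs := hflow.shore_eq t (times_mono ht₁ ht.1 ht.2)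
    simp only [hF, charVel, charQ, add_zero, hs, sub_zero]
    ring
  simp only [hdivEq] at hdiv
  rw [e1, e2, e3] at hdiv
  have e4 : (∫ t in (0 : ℝ)..t₁, (S - cgτ u (x₀ t) t) * regSqrt ε ((S - cgτ u (x₀ t) t) ^ 2))
      - (∫ z in (0 : ℝ)..ℓ, regSqrt ε (charQ η u x₀ S (z, 0)))
      = ∫ z in (0 : ℝ)..ℓ, ∫ t in (0 : ℝ)..t₁, I.indicator W (z, t) := by
    rw [hdiv]; ring
  rw [e4, ← Real.norm_eq_abs]
  have h5 : ∀ z, ‖∫ t in (0 : ℝ)..t₁, I.indicator W (z, t)‖ ≤ C * √ε * t₁ := fun z => by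
    have := intervalIntegral.norm_integral_le_of_norm_le_const (a := 0) (b := t₁)
      (f := fun t => I.indicator W (z, t)) (C := C * √ε) (fun t _ => hWb (z, t))
    rwa [sub_zero, abs_of_nonneg h0t] at this
  have := intervalIntegral.norm_integral_le_of_norm_le_const (a := 0) (b := ℓ)
      (f := fun z => ∫ t in (0 : ℝ)..t₁, I.indicator W (z, t)) (fun z _ => h5 z)
  rwa [sub_zero, abs_of_nonneg hℓ] at this

/-- Integrating the conservation law of `√((S - τ)² - σ²)` over the region between the shoreline
and the characteristic `τ + σ = S`. -/
theorem integral_sqrt_eq (hflow : IsFlow T η u x₀) (hbreak : NoBreaking T η u x₀)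
    (hT : 0 < T) (hu₀ : ∀ x, x₀ 0 ≤ x → u x 0 = 0) {t₁ b : ℝ}
    (ht₁ : t₁ ∈ times T) (hb : x₀ 0 ≤ b) (hb2 : shoreτ x₀ t₁ ^ 2 ≤ depth η b 0) :
    ∫ x in (x₀ 0)..b, √(shoreτ x₀ t₁ ^ 2 - depth η x 0)
      = ∫ t in (0 : ℝ)..t₁, (shoreτ x₀ t₁ - shoreτ x₀ t) ^ 2 := by
  set S := shoreτ x₀ t₁ with hS
  have h0t := ht₁.1
  have h0T : (0 : ℝ) ∈ times T := ⟨le_rfl, hT⟩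
  have hmem : ∀ t ∈ Icc 0 t₁, t ∈ times T := fun t ht => times_mono ht₁ ht.1 ht.2
  have hSθ : ∀ t ∈ Icc 0 t₁, 0 ≤ cgτ u (x₀ t) t ∧ cgτ u (x₀ t) t ≤ S := fun t ht => by
    rw [← hflow.shoreτ_eq hbreak (hmem t ht)]
    exact ⟨hflow.shoreτ_nonneg hbreak hT hu₀ (hmem t ht),
      (hflow.strictMonoOn_shoreτ hbreak).monotoneOn (hmem t ht) ht₁ ht.2⟩
  obtain ⟨L, hL⟩ := hflow.exists_invariant_ge hbreak hT hu₀ ht₁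
  obtain ⟨m, hm⟩ := (isCompact_Icc.image_of_continuousOn
    (hflow.shore_continuousOn_Icc ht₁)).bddBelow
  -- Wide enough to pass L at every time, the shoreline being at least m, and to pass b at time 0.
  set ℓ := max (L - m) (b - x₀ 0)
  have hbℓ : b - x₀ 0 ≤ ℓ := le_max_right _ _
  have hℓ : 0 ≤ ℓ := le_trans (by linarith) hbℓ
  have hright : ∀ t ∈ Icc 0 t₁, charQ η u x₀ S (ℓ, t) ≤ 0 := fun t ht => by
    have h1 := hm (mem_image_of_mem x₀ ht)
    have h2 : L - m ≤ ℓ := le_max_left _ _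
    exact hflow.sq_sub_depth_nonpos hbreak ht₁ ht (by linarith)
      ((hL t ht).2 _ (by linarith))
  have htop : ∀ z ∈ Icc 0 ℓ, charQ η u x₀ S (z, t₁) ≤ 0 := fun z hz => by
    have hx : x₀ t₁ ≤ x₀ t₁ + z := by linarith [hz.1]
    refine hflow.sq_sub_depth_nonpos hbreak ht₁ ⟨h0t, le_rfl⟩ hx ?_
    have h := (hflow.strictMonoOn_invariant_add hbreak ht₁).monotoneOn (mem_Ici.2 le_rfl) hx hx
    simpa only [hflow.cgσ_shore ht₁, ← hflow.shoreτ_eq hbreak ht₁, add_zero] using h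
  obtain ⟨C, hC0, hC⟩ := hflow.exists_abs_dx_u_le (ℓ := ℓ) ht₁
  have hθc : ContinuousOn (fun t => S - cgτ u (x₀ t) t) (Icc 0 t₁) :=
    continuousOn_const.sub ((continuousOn_id.sub (hflow.continuousOn_u_shore ht₁)).div_const 2)
  have hQ0c : ContinuousOn (fun z => charQ η u x₀ S (z, 0)) (Icc 0 ℓ) :=
    (hflow.continuousOn_charQ (S := S) (ℓ := ℓ) ht₁).comp (f := fun z => (z, (0 : ℝ)))
      (by fun_prop) fun z hz => ⟨hz, le_rfl, h0t⟩
  have key : (∫ t in (0 : ℝ)..t₁, (S - cgτ u (x₀ t) t) ^ 2)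
      = ∫ z in (0 : ℝ)..ℓ, √(charQ η u x₀ S (z, 0)) := by
    -- The three terms of K are the errors of the shoreline flux, of the source and of the initial
    -- integral.
    refine eq_of_forall_abs_sub_le_mul_sqrt (K := S * t₁ + C * t₁ * ℓ + ℓ)
      fun ε hε => ?_
    have h1 := hflow.regularized_identity hbreak ht₁ hℓ hε hC0 hC hright htop
    have h2 : |(∫ t in (0 : ℝ)..t₁, (S - cgτ u (x₀ t) t) ^ 2)
        - ∫ t in (0 : ℝ)..t₁, (S - cgτ u (x₀ t) t) * regSqrt ε ((S - cgτ u (x₀ t) t) ^ 2)|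
        ≤ S * √ε * t₁ := by
      rw [← intervalIntegral.integral_sub, ← Real.norm_eq_abs]
      · have := intervalIntegral.norm_integral_le_of_norm_le_const (a := 0) (b := t₁)
          (f := fun t => (S - cgτ u (x₀ t) t) ^ 2
            - (S - cgτ u (x₀ t) t) * regSqrt ε ((S - cgτ u (x₀ t) t) ^ 2)) (C := S * √ε)
          (fun t ht => by
            rw [uIoc_of_le h0t] at ht
            obtain ⟨h3, h4⟩ := hSθ t ⟨ht.1.le, ht.2⟩
            have h5 := abs_sqrt_sub_regSqrt_le hε ((S - cgτ u (x₀ t) t) ^ 2)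
            have h7 : 0 ≤ S - cgτ u (x₀ t) t := by linarith
            rw [Real.sqrt_sq h7] at h5
            have h6 : (S - cgτ u (x₀ t) t) ^ 2
                - (S - cgτ u (x₀ t) t) * regSqrt ε ((S - cgτ u (x₀ t) t) ^ 2)
                = (S - cgτ u (x₀ t) t) * ((S - cgτ u (x₀ t) t)
                  - regSqrt ε ((S - cgτ u (x₀ t) t) ^ 2)) := by ring
            rw [h6, norm_mul, Real.norm_eq_abs, Real.norm_eq_abs, abs_of_nonneg h7]
            exact mul_le_mul (by linarith) h5 (abs_nonneg _) (by linarith))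
        rwa [sub_zero, abs_of_nonneg h0t] at this
      · exact ((hθc.pow 2).intervalIntegrable_of_Icc h0t)
      · exact ((hθc.mul ((continuous_regSqrt hε).comp_continuousOn
          (hθc.pow 2))).intervalIntegrable_of_Icc h0t)
    have h3 : |(∫ z in (0 : ℝ)..ℓ, √(charQ η u x₀ S (z, 0)))
        - ∫ z in (0 : ℝ)..ℓ, regSqrt ε (charQ η u x₀ S (z, 0))| ≤ √ε * ℓ := by
      rw [← intervalIntegral.integral_sub, ← Real.norm_eq_abs]
      · have := intervalIntegral.norm_integral_le_of_norm_le_const (a := 0) (b := ℓ)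
          (f := fun z => √(charQ η u x₀ S (z, 0)) - regSqrt ε (charQ η u x₀ S (z, 0)))
          (fun z _ => abs_sqrt_sub_regSqrt_le hε _)
        rwa [sub_zero, abs_of_nonneg hℓ] at this
      · exact hQ0c.sqrt.intervalIntegrable_of_Icc hℓ
      · exact ((continuous_regSqrt hε).comp_continuousOn hQ0c).intervalIntegrable_of_Icc hℓ
    rw [abs_le] at *
    constructor <;> linarith [h1.1, h1.2, h2.1, h2.2, h3.1, h3.2]
  have hQ0 : ∀ z ∈ Icc 0 ℓ, charQ η u x₀ S (z, 0) = S ^ 2 - depth η (x₀ 0 + z) 0 := fun z hz => by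
    rw [charQ, cgτ, hu₀ _ (by simp only; linarith [hz.1])]
    simp
  have hcongr : (∫ z in (0 : ℝ)..ℓ, √(charQ η u x₀ S (z, 0)))
      = ∫ x in (x₀ 0)..(x₀ 0 + ℓ), √(S ^ 2 - depth η x 0) := by
    have := intervalIntegral.integral_comp_add_left (a := 0) (b := ℓ)
      (fun x => √(S ^ 2 - depth η x 0)) (x₀ 0)
    rw [add_zero] at this
    rw [← this]
    refine intervalIntegral.integral_congr fun z hz => ?_
    rw [uIcc_of_le hℓ] at hz
    simp only [hQ0 z hz]
  have hcd : ContinuousOn (fun x => √(S ^ 2 - depth η x 0)) (Ici (x₀ 0)) := fun x hx =>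
    (continuousAt_const.sub (hflow.hasDerivAt_depth h0T hx).continuousAt).sqrt.continuousWithinAt
  have hsplit := intervalIntegral.integral_add_adjacent_intervals (μ := volume)
    ((hcd.mono fun y hy => hy.1).intervalIntegrable_of_Icc hb)
    ((hcd.mono fun y hy => hb.trans hy.1).intervalIntegrable_of_Icc
      (show b ≤ x₀ 0 + ℓ by linarith))
  have hzero : ∫ x in b..(x₀ 0 + ℓ), √(S ^ 2 - depth η x 0) = 0 := by
    rw [intervalIntegral.integral_congr (g := fun _ => (0 : ℝ)), intervalIntegral.integral_zero]
    intro x hx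
    rw [uIcc_of_le (by linarith)] at hx
    refine Real.sqrt_eq_zero_of_nonpos ?_
    have := (hflow.strictMonoOn_depth hbreak h0T).monotoneOn hb (hb.trans hx.1) hx.1
    linarith
  rw [hzero, add_zero] at hsplit
  rw [hsplit, ← hcongr, ← key]
  refine intervalIntegral.integral_congr fun t ht => ?_
  rw [uIcc_of_le h0t] at ht
  exact (by rw [hflow.shoreτ_eq hbreak (hmem t ht)] :
    (S - cgτ u (x₀ t) t) ^ 2 = (S - shoreτ x₀ t) ^ 2)

end IsFlow

/-! ### From the integral identity to the Abel transform. -/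

section Abel

/-- Nonnegativity of the derivative makes it integrable even when it blows up at an endpoint, as the
kernels below do. -/
theorem lintegral_Ioc_deriv {g g' : ℝ → ℝ} {c R : ℝ} (hc : 0 ≤ c) (hcR : c ≤ R)
    (hzero : ∀ ρ ∈ Ioc 0 c, g' ρ = 0) (hcont : ContinuousOn g (Icc c R))
    (hderiv : ∀ ρ ∈ Ioo c R, HasDerivAt g (g' ρ) ρ) (hnonneg : ∀ ρ, 0 ≤ ρ → 0 ≤ g' ρ) :
    ∫⁻ ρ in Ioc 0 R, ENNReal.ofReal (g' ρ) = ENNReal.ofReal (g R - g c) := by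
  rw [← Ioc_union_Ioc_eq_Ioc hc hcR, lintegral_union measurableSet_Ioc
    (Ioc_disjoint_Ioc_of_le le_rfl)]
  have h1 : ∫⁻ ρ in Ioc 0 c, ENNReal.ofReal (g' ρ) = 0 := by
    rw [setLIntegral_congr_fun measurableSet_Ioc (g := fun _ => 0)
      fun ρ hρ => by simp [hzero ρ hρ]]
    simp
  have hint := intervalIntegral.integrableOn_deriv_of_nonneg hcont hderiv
    fun ρ hρ => hnonneg ρ (hc.trans hρ.1.le)
  rw [h1, zero_add, ← ofReal_integral_eq_lintegral_ofReal hint, ← intervalIntegral.integral_of_le hcR,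
    intervalIntegral.integral_eq_sub_of_hasDerivAt_of_le hcR hcont hderiv
      ((intervalIntegrable_iff_integrableOn_Ioc_of_le hcR).2 hint)]
  filter_upwards [ae_restrict_mem measurableSet_Ioc] with ρ hρ
  exact hnonneg ρ (hc.trans hρ.1.le)

/-- Together with division by zero giving zero, this makes ρ/√(ρ² - c) vanish below √c, so no
indicator functions are needed. -/
theorem sqrt_sq_sub_eq_zero {c ρ : ℝ} (hρ : ρ ∈ Ioc 0 √c) : √(ρ ^ 2 - c) = 0 := by
  refine Real.sqrt_eq_zero_of_nonpos ?_
  have := (Real.le_sqrt' hρ.1).1 hρ.2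
  linarith

theorem sub_pos_of_sqrt_lt {c ρ : ℝ} (hρ : √c < ρ) : 0 < ρ ^ 2 - c := by
  have := (Real.sqrt_lt' ((Real.sqrt_nonneg c).trans_lt hρ)).1 hρ
  linarith

theorem lintegral_div_sqrt {c R : ℝ} (hc : 0 ≤ c) (hR : 0 ≤ R) :
    ∫⁻ ρ in Ioc 0 R, ENNReal.ofReal (ρ / √(ρ ^ 2 - c)) = ENNReal.ofReal √(R ^ 2 - c) := by
  rcases le_total (√c) R with h | h
  · rw [lintegral_Ioc_deriv (g := fun ρ => √(ρ ^ 2 - c)) (Real.sqrt_nonneg c) h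
      (fun ρ hρ => by rw [sqrt_sq_sub_eq_zero hρ, div_zero]) (by fun_prop) (fun ρ hρ => ?_)
      (fun ρ hρ => by positivity)]
    · simp [Real.sq_sqrt hc]
    · have := (((hasDerivAt_id ρ).pow 2).sub_const c).sqrt (sub_pos_of_sqrt_lt hρ.1).ne'
      refine this.congr_deriv ?_
      simp only [id]
      field_simp
      simp
  · have h1 : R ^ 2 - c ≤ 0 := by
      have := (Real.le_sqrt hR hc).1 h
      linarith
    rw [Real.sqrt_eq_zero_of_nonpos h1, setLIntegral_congr_fun measurableSet_Ioc
      (g := fun _ => 0) fun ρ hρ => by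
        simp [sqrt_sq_sub_eq_zero (c := c) ⟨hρ.1, hρ.2.trans h⟩]]
    simp

theorem lintegral_max_sub {c R : ℝ} (hc : 0 ≤ c) :
    ∫⁻ ρ in Ioc 0 R, ENNReal.ofReal (2 * max (ρ - c) 0)
      = ENNReal.ofReal (max (R - c) 0 ^ 2) := by
  rcases le_total c R with h | h
  · rw [lintegral_Ioc_deriv (g := fun ρ => (ρ - c) ^ 2) hc h
      (fun ρ hρ => by rw [max_eq_right (by linarith [hρ.2]), mul_zero]) (by fun_prop)
      (fun ρ hρ => ?_) (fun ρ hρ => by positivity)]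
    · rw [max_eq_left (by linarith)]
      simp
    · refine (((hasDerivAt_id ρ).sub_const c).pow 2).congr_deriv ?_
      rw [max_eq_left (by linarith [hρ.1])]
      simp
  · rw [setLIntegral_congr_fun measurableSet_Ioc (g := fun _ => 0) fun ρ hρ => by
        simp [max_eq_right (show ρ - c ≤ 0 by linarith [hρ.2])],
      max_eq_right (by linarith)]
    simp

/-- The Beta integral `∫ ρ / (√(S² - ρ²) √(ρ² - c)) dρ = π / 2` over `(√c, S)`. -/
theorem lintegral_beta {c S : ℝ} (hc : 0 ≤ c) (hS : 0 < S) (hcS : c < S ^ 2) :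
    ∫⁻ ρ in Ioc 0 S, ENNReal.ofReal (ρ / √(ρ ^ 2 - c) * (1 / √(S ^ 2 - ρ ^ 2)))
      = ENNReal.ofReal (Real.pi / 2) := by
  have hd : 0 < S ^ 2 - c := by linarith
  -- The argument of the arcsine is affine in ρ² and runs from -1 at √c to 1 at S.
  rw [lintegral_Ioc_deriv
    (g := fun ρ => Real.arcsin ((2 * ρ ^ 2 - S ^ 2 - c) / (S ^ 2 - c)) / 2)
    (Real.sqrt_nonneg c) (Real.sqrt_le_left hS.le |>.2 hcS.le)
    (fun ρ hρ => by rw [sqrt_sq_sub_eq_zero hρ]; simp)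
    ((Real.continuous_arcsin.comp (by fun_prop)).div_const 2).continuousOn (fun ρ hρ => ?_)
    (fun ρ hρ => by positivity)]
  · rw [Real.sq_sqrt hc, show (2 * S ^ 2 - S ^ 2 - c) / (S ^ 2 - c) = 1 by field_simp; ring,
      show (2 * c - S ^ 2 - c) / (S ^ 2 - c) = -1 by field_simp; ring,
      Real.arcsin_one, Real.arcsin_neg_one]
    congr 1
    ring
  · have h1 := sub_pos_of_sqrt_lt hρ.1
    have hρ0 : 0 < ρ := (Real.sqrt_nonneg c).trans_lt hρ.1
    have h2 : 0 < S ^ 2 - ρ ^ 2 := by nlinarith [hρ.2]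
    have hlt1 : (2 * ρ ^ 2 - S ^ 2 - c) / (S ^ 2 - c) < 1 := by
      rw [div_lt_one hd]; linarith
    have hgt : -1 < (2 * ρ ^ 2 - S ^ 2 - c) / (S ^ 2 - c) := by
      rw [lt_div_iff₀ hd]; linarith
    have hin : HasDerivAt (fun ρ => (2 * ρ ^ 2 - S ^ 2 - c) / (S ^ 2 - c))
        (4 * ρ / (S ^ 2 - c)) ρ := by
      refine (((((hasDerivAt_id ρ).pow 2).const_mul 2).sub_const (S ^ 2)).sub_const c).div_const
        (S ^ 2 - c) |>.congr_deriv ?_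
      simp only [id]
      ring
    have hcomp := ((Real.hasDerivAt_arcsin hgt.ne' hlt1.ne).comp ρ hin).div_const 2
    refine hcomp.congr_deriv ?_
    have hsq : √(1 - ((2 * ρ ^ 2 - S ^ 2 - c) / (S ^ 2 - c)) ^ 2)
        = 2 * √(S ^ 2 - ρ ^ 2) * √(ρ ^ 2 - c) / (S ^ 2 - c) := by
      rw [Real.sqrt_eq_iff_mul_self_eq_of_pos (by positivity)]
      have e1 := Real.mul_self_sqrt h1.le
      have e2 := Real.mul_self_sqrt h2.le
      have : 2 * √(S ^ 2 - ρ ^ 2) * √(ρ ^ 2 - c) / (S ^ 2 - c)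
          * (2 * √(S ^ 2 - ρ ^ 2) * √(ρ ^ 2 - c) / (S ^ 2 - c))
          = 4 * (√(S ^ 2 - ρ ^ 2) * √(S ^ 2 - ρ ^ 2)) * (√(ρ ^ 2 - c) * √(ρ ^ 2 - c))
            / (S ^ 2 - c) ^ 2 := by
        field_simp
        ring
      rw [this, e1, e2]
      field_simp
      ring
    rw [hsq]
    have e1 := Real.sqrt_pos.2 h1
    have e2 := Real.sqrt_pos.2 h2
    field_simp
    ring

variable {a b t₁ S : ℝ} {h θ : ℝ → ℝ}

theorem measurable_div_sqrt (hh : Continuous h) :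
    Measurable fun p : ℝ × ℝ => ENNReal.ofReal (p.1 / √(p.1 ^ 2 - h p.2)) := by
  have := hh.measurable
  fun_prop

theorem measurable_max_sub (hθ : Continuous θ) :
    Measurable fun p : ℝ × ℝ => ENNReal.ofReal (2 * max (p.1 - θ p.2) 0) := by
  have := hθ.measurable
  fun_prop

/-- The two sides of the integral identity are primitives of densities that define the same
measure on `(0, S]`. -/
theorem withDensity_eq (hab : a ≤ b) (ht₁ : 0 ≤ t₁) (hS : 0 ≤ S) (hh : Continuous h)
    (hθ : Continuous θ) (hh0 : ∀ x ∈ Ioo a b, 0 ≤ h x) (hθ0 : ∀ t ∈ Ioc 0 t₁, 0 ≤ θ t)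
    (hid : ∀ R ∈ Icc 0 S, ∫ x in a..b, √(R ^ 2 - h x) = ∫ t in (0 : ℝ)..t₁, max (R - θ t) 0 ^ 2) :
    (volume.restrict (Ioc 0 S)).withDensity
      (fun ρ => ∫⁻ x in Ioo a b, ENNReal.ofReal (ρ / √(ρ ^ 2 - h x)))
    = (volume.restrict (Ioc 0 S)).withDensity
      (fun ρ => ∫⁻ t in Ioc 0 t₁, ENNReal.ofReal (2 * max (ρ - θ t) 0)) := by
  -- By Tonelli, the R-dependence is integrated pointwise in x. Densities are compared as measures
  -- because the inner integral may be infinite at individual ρ.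
  have h1 : ∀ R ∈ Icc 0 S, ∫⁻ ρ in Ioc 0 R,
      ∫⁻ x in Ioo a b, ENNReal.ofReal (ρ / √(ρ ^ 2 - h x))
      = ENNReal.ofReal (∫ x in a..b, √(R ^ 2 - h x)) := by
    intro R hR
    rw [lintegral_lintegral_swap (measurable_div_sqrt hh).aemeasurable,
      setLIntegral_congr_fun measurableSet_Ioo
        (fun x hx => lintegral_div_sqrt (hh0 x hx) hR.1),
      intervalIntegral.integral_of_le hab, integral_Ioc_eq_integral_Ioo,
      ofReal_integral_eq_lintegral_ofReal]
    · exact ((Continuous.integrableOn_Icc (by fun_prop)).mono_set Ioo_subset_Icc_self)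
    · exact Eventually.of_forall fun x => Real.sqrt_nonneg _
  have h2 : ∀ R ∈ Icc 0 S, ∫⁻ ρ in Ioc 0 R,
      ∫⁻ t in Ioc 0 t₁, ENNReal.ofReal (2 * max (ρ - θ t) 0)
      = ENNReal.ofReal (∫ t in (0 : ℝ)..t₁, max (R - θ t) 0 ^ 2) := by
    intro R _
    rw [lintegral_lintegral_swap (measurable_max_sub hθ).aemeasurable,
      setLIntegral_congr_fun measurableSet_Ioc
        (fun t ht => lintegral_max_sub (hθ0 t ht)),
      intervalIntegral.integral_of_le ht₁, ofReal_integral_eq_lintegral_ofReal]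
    · exact ((Continuous.integrableOn_Icc (by fun_prop)).mono_set Ioc_subset_Icc_self)
    · exact Eventually.of_forall fun x => by positivity
  -- Finiteness is what allows the two measures to be identified from half-lines.
  have hfin : IsFiniteMeasure ((volume.restrict (Ioc 0 S)).withDensity
      (fun ρ => ∫⁻ x in Ioo a b, ENNReal.ofReal (ρ / √(ρ ^ 2 - h x)))) := by
    refine isFiniteMeasure_withDensity ?_
    rw [h1 S ⟨hS, le_rfl⟩]
    exact ENNReal.ofReal_ne_top
  refine Measure.ext_of_Iic _ _ fun R => ?_
  rw [withDensity_apply _ measurableSet_Iic, withDensity_apply _ measurableSet_Iic,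
    Measure.restrict_restrict measurableSet_Iic]
  have hset : Iic R ∩ Ioc 0 S = Ioc 0 (max 0 (min R S)) := by
    ext y
    simp only [mem_inter_iff, mem_Iic, mem_Ioc, le_max_iff, le_min_iff]
    constructor
    · rintro ⟨h1, h2, h3⟩
      exact ⟨h2, Or.inr ⟨h1, h3⟩⟩
    · rintro ⟨h1, h2 | h2⟩
      · linarith
      · exact ⟨h2.1, h1, h2.2⟩
  have hmem : max 0 (min R S) ∈ Icc 0 S := ⟨le_max_left _ _, max_le hS (min_le_right _ _)⟩
  rw [hset, h1 _ hmem, h2 _ hmem, hid _ hmem]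

/-- Integrate 1/√(S² - ρ²) against the two equal measures. On the left, Tonelli leaves the Beta
integral π/2 for each x; since that total is finite, integrability on the right is automatic. -/
theorem abel_of_integral_identity (hab : a ≤ b) (ht₁ : 0 ≤ t₁) (hS : 0 < S) (hh : Continuous h)
    (hθ : Continuous θ) (hh0 : ∀ x ∈ Ioo a b, 0 ≤ h x) (hhS : ∀ x ∈ Ioo a b, h x < S ^ 2)
    (hθ0 : ∀ t ∈ Ioc 0 t₁, 0 ≤ θ t)
    (hid : ∀ R ∈ Icc 0 S, ∫ x in a..b, √(R ^ 2 - h x) = ∫ t in (0 : ℝ)..t₁, max (R - θ t) 0 ^ 2) :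
    IntervalIntegrable (fun ρ => 2 * (∫ t in (0 : ℝ)..t₁, max (ρ - θ t) 0) / √(S ^ 2 - ρ ^ 2))
      volume 0 S ∧
    ∫ ρ in (0 : ℝ)..S, 2 * (∫ t in (0 : ℝ)..t₁, max (ρ - θ t) 0) / √(S ^ 2 - ρ ^ 2)
      = Real.pi / 2 * (b - a) := by
  have hK : Measurable fun ρ : ℝ => ENNReal.ofReal (1 / √(S ^ 2 - ρ ^ 2)) := by fun_prop
  have hf1 : Measurable fun ρ => ∫⁻ x in Ioo a b, ENNReal.ofReal (ρ / √(ρ ^ 2 - h x)) :=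
    (measurable_div_sqrt hh).lintegral_prod_right'
  have hf2 : Measurable fun ρ => ∫⁻ t in Ioc 0 t₁, ENNReal.ofReal (2 * max (ρ - θ t) 0) :=
    (measurable_max_sub hθ).lintegral_prod_right'
  have heq := congrArg (fun μ => ∫⁻ ρ, ENNReal.ofReal (1 / √(S ^ 2 - ρ ^ 2)) ∂μ)
    (withDensity_eq hab ht₁ hS.le hh hθ hh0 hθ0 hid)
  simp only [lintegral_withDensity_eq_lintegral_mul _ hf1 hK,
    lintegral_withDensity_eq_lintegral_mul _ hf2 hK, Pi.mul_apply] at heq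
  have hleft : ∫⁻ ρ in Ioc 0 S, (∫⁻ x in Ioo a b, ENNReal.ofReal (ρ / √(ρ ^ 2 - h x)))
      * ENNReal.ofReal (1 / √(S ^ 2 - ρ ^ 2)) = ENNReal.ofReal (Real.pi / 2 * (b - a)) := by
    have e1 : ∀ ρ ∈ Ioc 0 S, (∫⁻ x in Ioo a b, ENNReal.ofReal (ρ / √(ρ ^ 2 - h x)))
        * ENNReal.ofReal (1 / √(S ^ 2 - ρ ^ 2))
        = ∫⁻ x in Ioo a b, ENNReal.ofReal (ρ / √(ρ ^ 2 - h x) * (1 / √(S ^ 2 - ρ ^ 2))) := by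
      intro ρ hρ
      rw [← lintegral_mul_const' _ _ ENNReal.ofReal_ne_top]
      refine lintegral_congr fun x => ?_
      rw [ENNReal.ofReal_mul (div_nonneg hρ.1.le (Real.sqrt_nonneg _))]
    have hmeas : Measurable fun p : ℝ × ℝ =>
        ENNReal.ofReal (p.1 / √(p.1 ^ 2 - h p.2) * (1 / √(S ^ 2 - p.1 ^ 2))) := by
      have := hh.measurable
      fun_prop
    rw [setLIntegral_congr_fun measurableSet_Ioc e1,
      lintegral_lintegral_swap hmeas.aemeasurable,
      setLIntegral_congr_fun measurableSet_Ioo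
        (fun x hx => lintegral_beta (hh0 x hx) hS (hhS x hx)), setLIntegral_const,
      Real.volume_Ioo, ENNReal.ofReal_mul (by positivity)]
  have hI : Continuous fun ρ => ∫ t in (0 : ℝ)..t₁, max (ρ - θ t) 0 :=
    intervalIntegral.continuous_parametric_intervalIntegral_of_continuous' (by fun_prop) _ _
  have hI0 : ∀ ρ, 0 ≤ ∫ t in (0 : ℝ)..t₁, max (ρ - θ t) 0 := fun ρ =>
    intervalIntegral.integral_nonneg ht₁ fun t _ => le_max_right _ _
  have hright : ∀ ρ, (∫⁻ t in Ioc 0 t₁, ENNReal.ofReal (2 * max (ρ - θ t) 0))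
      * ENNReal.ofReal (1 / √(S ^ 2 - ρ ^ 2))
      = ENNReal.ofReal (2 * (∫ t in (0 : ℝ)..t₁, max (ρ - θ t) 0) / √(S ^ 2 - ρ ^ 2)) := by
    intro ρ
    rw [← ofReal_integral_eq_lintegral_ofReal, ← ENNReal.ofReal_mul, integral_const_mul,
      ← intervalIntegral.integral_of_le ht₁, mul_one_div]
    · exact integral_nonneg fun t => by positivity
    · exact ((Continuous.integrableOn_Icc (by fun_prop)).mono_set Ioc_subset_Icc_self)
    · exact Eventually.of_forall fun t => by positivity
  rw [hleft] at heq
  simp only [hright] at heq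
  have hmeas : AEStronglyMeasurable
      (fun ρ => 2 * (∫ t in (0 : ℝ)..t₁, max (ρ - θ t) 0) / √(S ^ 2 - ρ ^ 2))
      (volume.restrict (Ioc 0 S)) := by
    have := hI.measurable
    exact (Measurable.aestronglyMeasurable (by fun_prop))
  have hnn : 0 ≤ᵐ[volume.restrict (Ioc 0 S)]
      (fun ρ => 2 * (∫ t in (0 : ℝ)..t₁, max (ρ - θ t) 0) / √(S ^ 2 - ρ ^ 2)) :=
    Eventually.of_forall fun ρ => div_nonneg (mul_nonneg (by norm_num) (hI0 ρ)) (Real.sqrt_nonneg _)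
  constructor
  · rw [intervalIntegrable_iff_integrableOn_Ioc_of_le hS.le]
    refine (lintegral_ofReal_ne_top_iff_integrable hmeas hnn).1 ?_
    rw [← heq]
    exact ENNReal.ofReal_ne_top
  · rw [intervalIntegral.integral_of_le hS.le, integral_eq_lintegral_of_nonneg_ae hnn hmeas,
      ← heq, ENNReal.toReal_ofReal]
    exact mul_nonneg (by positivity) (by linarith)

theorem integral_quadratic_div_sqrt (A : ℝ) (hS : 0 < S) :
    IntervalIntegrable (fun ρ => (A + 2 * ρ ^ 2) / √(S ^ 2 - ρ ^ 2)) volume 0 S ∧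
    ∫ ρ in (0 : ℝ)..S, (A + 2 * ρ ^ 2) / √(S ^ 2 - ρ ^ 2) = Real.pi / 2 * (A + S ^ 2) := by
  have hasin : ∀ ρ ∈ Ioo 0 S, HasDerivAt (fun ρ => Real.arcsin (ρ / S)) (1 / √(S ^ 2 - ρ ^ 2)) ρ := by
    intro ρ hρ
    have h0 := hρ.1
    have h1 : ρ / S < 1 := (div_lt_one hS).2 hρ.2
    have h2 : -1 < ρ / S := lt_of_lt_of_le (by norm_num) (by positivity : 0 ≤ ρ / S)
    refine ((Real.hasDerivAt_arcsin h2.ne' h1.ne).comp ρ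
      ((hasDerivAt_id ρ).div_const S)).congr_deriv ?_
    have h3 : S ^ 2 - ρ ^ 2 = S ^ 2 * (1 - (ρ / S) ^ 2) := by field_simp
    rw [h3, Real.sqrt_mul (by positivity), Real.sqrt_sq hS.le]
    have h4 : 0 < √(1 - (ρ / S) ^ 2) := Real.sqrt_pos.2 (by nlinarith)
    field_simp
  have hc1 : ContinuousOn (fun ρ => Real.arcsin (ρ / S)) (Icc 0 S) :=
    (Real.continuous_arcsin.comp (by fun_prop)).continuousOn
  have hi0 : IntervalIntegrable (fun ρ => 1 / √(S ^ 2 - ρ ^ 2)) volume 0 S :=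
    (intervalIntegrable_iff_integrableOn_Ioc_of_le hS.le).2
      (intervalIntegral.integrableOn_deriv_of_nonneg hc1 hasin fun ρ _ => by positivity)
  have hi : IntervalIntegrable (fun ρ => (A + 2 * ρ ^ 2) / √(S ^ 2 - ρ ^ 2)) volume 0 S := by
    have := hi0.continuousOn_mul (f := fun ρ => 1 / √(S ^ 2 - ρ ^ 2))
      (g := fun ρ => A + 2 * ρ ^ 2) (by fun_prop)
    simpa only [mul_one_div] using this
  refine ⟨hi, ?_⟩
  rw [intervalIntegral.integral_eq_sub_of_hasDerivAt_of_le hS.le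
    (f := fun ρ => (A + S ^ 2) * Real.arcsin (ρ / S) - ρ * √(S ^ 2 - ρ ^ 2))
    ((continuousOn_const.mul hc1).sub (by fun_prop)) (fun ρ hρ => ?_) hi]
  · simp [hS.ne']
    ring
  · have hp : 0 < S ^ 2 - ρ ^ 2 := by nlinarith [hρ.1, hρ.2]
    have h1 := Real.sqrt_pos.2 hp
    have h2 := Real.sq_sqrt hp.le
    have hsq : HasDerivAt (fun ρ => √(S ^ 2 - ρ ^ 2)) (-ρ / √(S ^ 2 - ρ ^ 2)) ρ := by
      refine HasDerivAt.congr_deriv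
        (((hasDerivAt_pow 2 ρ).const_sub (S ^ 2)).sqrt hp.ne') ?_
      field_simp
      simp
    refine (((hasin ρ hρ).const_mul (A + S ^ 2)).sub
      ((hasDerivAt_id ρ).mul hsq)).congr_deriv ?_
    simp only [id]
    field_simp
    rw [h2]
    ring

end Abel

/-! ### Semiconcavity in R of ∫ √(R² - h). -/

section SecondDifference

theorem sq_mul_sqrt_sq {R : ℝ} (hR : 0 ≤ R) : R ^ 2 * √(R ^ 2) = R ^ 3 := by
  rw [Real.sqrt_sq hR]; ring

theorem mul_sqrt_of_nonpos {y : ℝ} (hy : y ≤ 0) : y * √y = 0 := by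
  rw [Real.sqrt_eq_zero_of_nonpos hy, mul_zero]

/-- `R ↦ (R² - c)₊^{3/2}` is midpoint convex on `R ≥ 0`. -/
theorem second_difference_nonneg (c : ℝ) {R d : ℝ} (hd : 0 ≤ d) (hR : d ≤ R) :
    0 ≤ ((R - d) ^ 2 - c) * √((R - d) ^ 2 - c) + ((R + d) ^ 2 - c) * √((R + d) ^ 2 - c)
      - 2 * ((R ^ 2 - c) * √(R ^ 2 - c)) := by
  have hder : ∀ r : ℝ, HasDerivAt (fun r : ℝ => (r ^ 2 - c) * √(r ^ 2 - c))
      (3 * r * √(r ^ 2 - c)) r := fun r => by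
    refine ((hasDerivAt_mul_sqrt (r ^ 2 - c)).comp r
      ((hasDerivAt_pow 2 r).sub_const c)).congr_deriv ?_
    push_cast
    ring
  have hconv : ConvexOn ℝ (Ici 0) (fun r : ℝ => (r ^ 2 - c) * √(r ^ 2 - c)) := by
    refine MonotoneOn.convexOn_of_deriv (convex_Ici 0)
      (fun r _ => (hder r).continuousAt.continuousWithinAt)
      (fun r _ => (hder r).differentiableAt.differentiableWithinAt) ?_
    rw [interior_Ici]
    intro r hr s hs hrs
    rw [(hder r).deriv, (hder s).deriv]
    have hr : 0 < r := hr
    have h1 : √(r ^ 2 - c) ≤ √(s ^ 2 - c) := Real.sqrt_le_sqrt (by nlinarith)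
    exact mul_le_mul (by linarith) h1 (Real.sqrt_nonneg _) (by linarith)
  have h := hconv.2 (show R - d ∈ Ici (0 : ℝ) from sub_nonneg.2 hR)
    (show R + d ∈ Ici (0 : ℝ) from by simp only [mem_Ici]; linarith)
    (show (0 : ℝ) ≤ 1 / 2 by norm_num) (show (0 : ℝ) ≤ 1 / 2 by norm_num) (by norm_num)
  have e : (1 / 2 : ℝ) • (R - d) + (1 / 2 : ℝ) • (R + d) = R := by
    simp only [smul_eq_mul]; ring
  rw [e] at h
  simp only [smul_eq_mul] at h
  linarith

theorem max_sq_second_difference_nonneg (y : ℝ) {d : ℝ} (hd : 0 ≤ d) :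
    0 ≤ max (y - d) 0 ^ 2 + max (y + d) 0 ^ 2 - 2 * max y 0 ^ 2 := by
  rcases le_total y 0 with h | h
  · rw [max_eq_right h]
    nlinarith [sq_nonneg (max (y - d) 0), sq_nonneg (max (y + d) 0)]
  · rw [max_eq_left h, max_eq_left (show 0 ≤ y + d by linarith)]
    rcases le_total (y - d) 0 with h1 | h1
    · rw [max_eq_right h1]
      nlinarith
    · rw [max_eq_left h1]
      nlinarith

variable {a b S : ℝ} {h h' h'' : ℝ → ℝ}

/-- Second differences of √(R² - h) in R are too singular to bound pointwise; integrating by parts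
against 1/h' trades them for the power 3/2, at the cost of one derivative of h'. -/
theorem integral_sqrt_by_parts (hab : a ≤ b) (hh : ∀ x ∈ Icc a b, HasDerivAt h (h' x) x)
    (hh' : ∀ x ∈ Icc a b, HasDerivAt h' (h'' x) x) (hc : ContinuousOn h'' (Icc a b))
    (hpos : ∀ x ∈ Icc a b, 0 < h' x) (ha : h a = 0) {R : ℝ} (hR : 0 ≤ R) (hRb : R ^ 2 ≤ h b) :
    ∫ x in a..b, √(R ^ 2 - h x) = 2 / 3 * (R ^ 3 / h' a
      + ∫ x in a..b, (R ^ 2 - h x) * √(R ^ 2 - h x) * (-h'' x / h' x ^ 2)) := by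
  have hcont : ContinuousOn h (Icc a b) := fun x hx => (hh x hx).continuousAt.continuousWithinAt
  have hcont' : ContinuousOn h' (Icc a b) := fun x hx => (hh' x hx).continuousAt.continuousWithinAt
  have hd : ∀ x ∈ uIcc a b, HasDerivAt (fun x => (R ^ 2 - h x) * √(R ^ 2 - h x) * (h' x)⁻¹)
      (-(3 / 2) * √(R ^ 2 - h x)
        + (R ^ 2 - h x) * √(R ^ 2 - h x) * (-h'' x / h' x ^ 2)) x := by
    intro x hx
    rw [uIcc_of_le hab] at hx
    have hp := hpos x hx
    refine (((hasDerivAt_mul_sqrt (R ^ 2 - h x)).comp x ((hh x hx).const_sub (R ^ 2))).mul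
      ((hh' x hx).inv hp.ne')).congr_deriv ?_
    simp only [Function.comp, Pi.inv_apply]
    field_simp
  have hi1 : IntervalIntegrable (fun x => √(R ^ 2 - h x)) volume a b :=
    (continuousOn_const.sub hcont).sqrt.intervalIntegrable_of_Icc hab
  have hi2 : IntervalIntegrable
      (fun x => (R ^ 2 - h x) * √(R ^ 2 - h x) * (-h'' x / h' x ^ 2)) volume a b :=
    (((continuousOn_const.sub hcont).mul (continuousOn_const.sub hcont).sqrt).mul
      (hc.neg.div (hcont'.pow 2) fun x hx =>
        pow_ne_zero 2 (hpos x hx).ne')).intervalIntegrable_of_Icc hab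
  have hftc := intervalIntegral.integral_eq_sub_of_hasDerivAt hd ((hi1.const_mul _).add hi2)
  rw [intervalIntegral.integral_add (hi1.const_mul _) hi2, intervalIntegral.integral_const_mul,
    mul_sqrt_of_nonpos (sub_nonpos.2 hRb), ha, sub_zero, sq_mul_sqrt_sq hR, zero_mul] at hftc
  rw [div_eq_mul_inv (R ^ 3)]
  linarith

/-- The weight h' makes the integral explicit and serves as the comparison weight. -/
theorem integral_mul_sqrt_mul_deriv (hab : a ≤ b) (hh : ∀ x ∈ Icc a b, HasDerivAt h (h' x) x)
    (hcont' : ContinuousOn h' (Icc a b)) (ha : h a = 0) {R : ℝ} (hR : 0 ≤ R) (hRb : R ^ 2 ≤ h b) :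
    ∫ x in a..b, (R ^ 2 - h x) * √(R ^ 2 - h x) * h' x = 2 / 5 * R ^ 5 := by
  have hcont : ContinuousOn h (Icc a b) := fun x hx => (hh x hx).continuousAt.continuousWithinAt
  have hd : ∀ x ∈ uIcc a b,
      HasDerivAt (fun x => -(2 / 5) * ((R ^ 2 - h x) * ((R ^ 2 - h x) * √(R ^ 2 - h x))))
      ((R ^ 2 - h x) * √(R ^ 2 - h x) * h' x) x := by
    intro x hx
    rw [uIcc_of_le hab] at hx
    have h1 := (hh x hx).const_sub (R ^ 2)
    refine ((h1.mul ((hasDerivAt_mul_sqrt (R ^ 2 - h x)).comp x h1)).const_mul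
      (-(2 / 5))).congr_deriv ?_
    simp only [Function.comp]
    ring
  rw [intervalIntegral.integral_eq_sub_of_hasDerivAt hd
    ((((continuousOn_const.sub hcont).mul (continuousOn_const.sub hcont).sqrt).mul
      hcont').intervalIntegrable_of_Icc hab), mul_sqrt_of_nonpos (sub_nonpos.2 hRb), ha, sub_zero,
    sq_mul_sqrt_sq hR]
  ring

/-- The left-hand side of the integral identity is semiconcave in `R`. -/
theorem exists_second_difference_le (hab : a ≤ b) (hh : ∀ x ∈ Icc a b, HasDerivAt h (h' x) x)
    (hh' : ∀ x ∈ Icc a b, HasDerivAt h' (h'' x) x) (hc : ContinuousOn h'' (Icc a b))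
    (hpos : ∀ x ∈ Icc a b, 0 < h' x) (ha : h a = 0) (hS : 0 ≤ S) (hb : h b = S ^ 2) :
    ∃ C, 0 ≤ C ∧ ∀ R d, 0 ≤ d → d ≤ R → R + d ≤ S →
      (∫ x in a..b, √((R - d) ^ 2 - h x)) + (∫ x in a..b, √((R + d) ^ 2 - h x))
        - 2 * (∫ x in a..b, √(R ^ 2 - h x)) ≤ C * d ^ 2 := by
  have hcont : ContinuousOn h (Icc a b) := fun x hx => (hh x hx).continuousAt.continuousWithinAt
  have hcont' : ContinuousOn h' (Icc a b) := fun x hx => (hh' x hx).continuousAt.continuousWithinAt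
  have hmc : ContinuousOn (fun x => -h'' x / h' x ^ 2) (Icc a b) :=
    hc.neg.div (hcont'.pow 2) fun x hx => pow_ne_zero 2 (hpos x hx).ne'
  -- M bounds -h''/h'³, so the weight from the integration by parts is at most Mh'. An upper bound
  -- suffices because the second difference it multiplies is nonnegative.
  obtain ⟨M, hM⟩ := isCompact_Icc.exists_bound_of_continuousOn
    (hmc.div hcont' fun x hx => (hpos x hx).ne')
  have hM0 : 0 ≤ M := (norm_nonneg _).trans (hM a ⟨le_rfl, hab⟩)
  have hMm : ∀ x ∈ Icc a b, -h'' x / h' x ^ 2 ≤ M * h' x := fun x hx => by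
    have h1 : -h'' x / h' x ^ 2 / h' x ≤ M := (le_abs_self _).trans (hM x hx)
    rwa [div_le_iff₀ (hpos x hx)] at h1
  have hpa := hpos a ⟨le_rfl, hab⟩
  -- The second difference of R³ is 6Rd², and that of (2/5)R⁵ is (8R³ + 4Rd²)d² ≤ 12S³d².
  refine ⟨2 / 3 * (6 * S / h' a + M * (12 * S ^ 3)), by positivity, fun R d hd hR hRS => ?_⟩
  have hRd : 0 ≤ R - d := by linarith
  have hR0 : 0 ≤ R := by linarith
  have hle : ∀ r, 0 ≤ r → r ≤ S → r ^ 2 ≤ h b := fun r h0 h1 => by rw [hb]; gcongr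
  have hb1 := hle (R - d) hRd (by linarith)
  have hb2 := hle (R + d) (by linarith) hRS
  have hb3 := hle R hR0 (by linarith)
  have hφ : ∀ r : ℝ, ContinuousOn (fun x => (r ^ 2 - h x) * √(r ^ 2 - h x)) (Icc a b) := fun r =>
    (continuousOn_const.sub hcont).mul (continuousOn_const.sub hcont).sqrt
  have hi : ∀ (r : ℝ) (k : ℝ → ℝ), ContinuousOn k (Icc a b) → IntervalIntegrable
      (fun x => (r ^ 2 - h x) * √(r ^ 2 - h x) * k x) volume a b := fun r k hk =>
    ((hφ r).mul hk).intervalIntegrable_of_Icc hab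
  have hcomb : ∀ k : ℝ → ℝ, ContinuousOn k (Icc a b) →
      (∫ x in a..b, ((R - d) ^ 2 - h x) * √((R - d) ^ 2 - h x) * k x)
      + (∫ x in a..b, ((R + d) ^ 2 - h x) * √((R + d) ^ 2 - h x) * k x)
      - 2 * (∫ x in a..b, (R ^ 2 - h x) * √(R ^ 2 - h x) * k x)
      = ∫ x in a..b, (((R - d) ^ 2 - h x) * √((R - d) ^ 2 - h x)
        + ((R + d) ^ 2 - h x) * √((R + d) ^ 2 - h x)
        - 2 * ((R ^ 2 - h x) * √(R ^ 2 - h x))) * k x := by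
    intro k hk
    rw [← intervalIntegral.integral_const_mul, ← intervalIntegral.integral_add (hi _ k hk)
      (hi _ k hk), ← intervalIntegral.integral_sub ((hi _ k hk).add (hi _ k hk))
      ((hi _ k hk).const_mul 2)]
    refine intervalIntegral.integral_congr fun x _ => ?_
    ring
  have hDc : ContinuousOn (fun x => ((R - d) ^ 2 - h x) * √((R - d) ^ 2 - h x)
        + ((R + d) ^ 2 - h x) * √((R + d) ^ 2 - h x)
        - 2 * ((R ^ 2 - h x) * √(R ^ 2 - h x))) (Icc a b) :=
    ((hφ _).add (hφ _)).sub (continuousOn_const.mul (hφ _))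
  have hmain := intervalIntegral.integral_mono_on (μ := volume) hab
    ((hDc.mul hmc).intervalIntegrable_of_Icc hab)
    ((hDc.mul (continuousOn_const.mul hcont')).intervalIntegrable_of_Icc hab)
    fun x hx => mul_le_mul_of_nonneg_left (hMm x hx) (second_difference_nonneg (h x) hd hR)
  simp only [Pi.mul_apply] at hmain
  rw [← hcomb _ hmc, ← hcomb (fun x => M * h' x) (continuousOn_const.mul hcont')] at hmain
  have hI : ∀ r, 0 ≤ r → r ^ 2 ≤ h b →
      ∫ x in a..b, (r ^ 2 - h x) * √(r ^ 2 - h x) * (M * h' x) = M * (2 / 5 * r ^ 5) := by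
    intro r h0 h1
    rw [← integral_mul_sqrt_mul_deriv hab hh hcont' ha h0 h1,
      ← intervalIntegral.integral_const_mul]
    refine intervalIntegral.integral_congr fun x _ => ?_
    ring
  rw [hI _ hRd hb1, hI _ (by linarith) hb2, hI _ hR0 hb3] at hmain
  rw [integral_sqrt_by_parts hab hh hh' hc hpos ha hRd hb1,
    integral_sqrt_by_parts hab hh hh' hc hpos ha (by linarith) hb2,
    integral_sqrt_by_parts hab hh hh' hc hpos ha hR0 hb3]
  have hcube : (R - d) ^ 3 / h' a + (R + d) ^ 3 / h' a - 2 * (R ^ 3 / h' a)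
      ≤ 6 * S / h' a * d ^ 2 := by
    have e1 : (R - d) ^ 3 / h' a + (R + d) ^ 3 / h' a - 2 * (R ^ 3 / h' a)
        = 6 * R / h' a * d ^ 2 := by field_simp; ring
    rw [e1]
    gcongr
    linarith
  have hquint : 2 / 5 * (R - d) ^ 5 + 2 / 5 * (R + d) ^ 5 - 2 * (2 / 5 * R ^ 5)
      ≤ 12 * S ^ 3 * d ^ 2 := by
    have e1 : 2 / 5 * (R - d) ^ 5 + 2 / 5 * (R + d) ^ 5 - 2 * (2 / 5 * R ^ 5)
        = (8 * R ^ 3 + 4 * (R * d ^ 2)) * d ^ 2 := by ring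
    rw [e1]
    gcongr
    have h1 : R ^ 3 ≤ S ^ 3 := by gcongr; linarith
    have h2 : R * d ^ 2 ≤ S * S ^ 2 := by gcongr <;> linarith
    nlinarith
  nlinarith [mul_le_mul_of_nonneg_left hquint hM0]

end SecondDifference

/-! ### Recovery of the initial data from the shoreline, and the case of infinite time. -/

namespace IsFlow

variable {T : EReal} {η u : ℝ → ℝ → ℝ} {x₀ : ℝ → ℝ} {x t : ℝ}

theorem continuousOn_shoreτ_Icc (hflow : IsFlow T η u x₀) (hbreak : NoBreaking T η u x₀)
    (ht : t ∈ times T) : ContinuousOn (shoreτ x₀) (Icc 0 t) :=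
  (hflow.continuousOn_shoreτ hbreak).mono fun _ hr => times_mono ht hr.1 hr.2

/-- As θ is increasing, the positive part switches off after t. The time interval thus becomes
independent of R = θ(t), as Tonelli requires. -/
theorem integral_max_shoreτ (hflow : IsFlow T η u x₀) (hbreak : NoBreaking T η u x₀)
    {t₁ : ℝ} (ht₁ : t₁ ∈ times T) (ht : t ∈ Icc 0 t₁) {g : ℝ → ℝ}
    (hg : Continuous g) (hg0 : g 0 = 0) :
    ∫ s in (0 : ℝ)..t₁, g (max (shoreτ x₀ t - shoreτ x₀ s) 0)
      = ∫ s in (0 : ℝ)..t, g (shoreτ x₀ t - shoreτ x₀ s) := by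
  have hmono := (hflow.strictMonoOn_shoreτ hbreak).monotoneOn
  have hmem : ∀ s ∈ Icc 0 t₁, s ∈ times T := fun s hs => times_mono ht₁ hs.1 hs.2
  have hc : ContinuousOn (fun s => g (max (shoreτ x₀ t - shoreτ x₀ s) 0)) (Icc 0 t₁) :=
    hg.comp_continuousOn (ContinuousOn.sup (continuousOn_const.sub
      (hflow.continuousOn_shoreτ_Icc hbreak ht₁)) continuousOn_const)
  rw [← intervalIntegral.integral_add_adjacent_intervals (b := t)
    ((hc.mono (Icc_subset_Icc_right ht.2)).intervalIntegrable_of_Icc ht.1)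
    ((hc.mono (Icc_subset_Icc_left ht.1)).intervalIntegrable_of_Icc ht.2)]
  have h1 : ∫ s in t..t₁, g (max (shoreτ x₀ t - shoreτ x₀ s) 0) = 0 := by
    rw [intervalIntegral.integral_congr (g := fun _ => (0 : ℝ)), intervalIntegral.integral_zero]
    intro s hs
    rw [uIcc_of_le ht.2] at hs
    have := hmono (hmem t ht) (hmem s ⟨ht.1.trans hs.1, hs.2⟩) hs.1
    simp only [max_eq_right (sub_nonpos.2 this), hg0]
  rw [h1, add_zero]
  refine intervalIntegral.integral_congr fun s hs => ?_
  rw [uIcc_of_le ht.1] at hs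
  have := hmono (hmem s ⟨hs.1, hs.2.trans ht.2⟩) (hmem t ht) hs.2
  simp only [max_eq_left (sub_nonneg.2 this)]

theorem exists_shoreτ_eq (hflow : IsFlow T η u x₀) (hbreak : NoBreaking T η u x₀)
    (hT : 0 < T) (hu₀ : ∀ x, x₀ 0 ≤ x → u x 0 = 0) {t₁ R : ℝ}
    (ht₁ : t₁ ∈ times T) (hR : R ∈ Icc 0 (shoreτ x₀ t₁)) : ∃ t ∈ Icc 0 t₁, shoreτ x₀ t = R := by
  have := intermediate_value_Icc ht₁.1 (hflow.continuousOn_shoreτ_Icc hbreak ht₁)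
  rw [hflow.shoreτ_zero hbreak hT hu₀] at this
  exact this hR

theorem integral_sqrt_eq_max (hflow : IsFlow T η u x₀) (hbreak : NoBreaking T η u x₀)
    (hT : 0 < T) (hu₀ : ∀ x, x₀ 0 ≤ x → u x 0 = 0) {t₁ b : ℝ}
    (ht₁ : t₁ ∈ times T) (hb : x₀ 0 ≤ b) (hb2 : shoreτ x₀ t₁ ^ 2 ≤ depth η b 0) {R : ℝ}
    (hR : R ∈ Icc 0 (shoreτ x₀ t₁)) :
    ∫ x in (x₀ 0)..b, √(R ^ 2 - depth η x 0)
      = ∫ t in (0 : ℝ)..t₁, max (R - shoreτ x₀ t) 0 ^ 2 := by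
  obtain ⟨t, ht, rfl⟩ := hflow.exists_shoreτ_eq hbreak hT hu₀ ht₁ hR
  rw [hflow.integral_sqrt_eq hbreak hT hu₀ (times_mono ht₁ ht.1 ht.2) hb
    (le_trans (pow_le_pow_left₀ hR.1 hR.2 2) hb2),
    hflow.integral_max_shoreτ hbreak ht₁ ht (g := fun y => y ^ 2) (by fun_prop) (by simp)]

theorem integral_shoreτ (hflow : IsFlow T η u x₀) (hbreak : NoBreaking T η u x₀)
    (ht : t ∈ times T) :
    ∫ s in (0 : ℝ)..t, shoreτ x₀ s = (t ^ 2 / 2 - (x₀ t - x₀ 0)) / 2 := by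
  have hmem : ∀ s ∈ Icc 0 t, s ∈ times T := fun s hs => times_mono ht hs.1 hs.2
  rw [intervalIntegral.integral_eq_sub_of_hasDerivAt_of_le ht.1
    (f := fun s => (s ^ 2 / 2 - x₀ s) / 2)
    (((by fun_prop : ContinuousOn (fun s : ℝ => s ^ 2 / 2) _).sub
      (hflow.shore_continuousOn_Icc ht)).div_const 2) (fun s hs => ?_)
    ((hflow.continuousOn_shoreτ_Icc hbreak ht).intervalIntegrable_of_Icc ht.1)]
  · ring
  · have hs' := hmem s (Ioo_subset_Icc_self hs)
    refine ((((hasDerivAt_pow 2 s).div_const 2).sub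
      (hflow.hasDerivAt_shore hbreak hs' hs.1)).div_const 2).congr_deriv ?_
    rw [hflow.shoreτ_eq hbreak hs', cgτ]
    push_cast
    ring

/-- Integrating v₀ = t - 2θ expresses x₀(t) through ∫θ; completing the square in t with ρ = θ(t)
leaves 2ρ² and the integral of (ρ - θ)₊. -/
theorem shoreΨ_eq (hflow : IsFlow T η u x₀) (hbreak : NoBreaking T η u x₀)
    (hT : 0 < T) (hu₀ : ∀ x, x₀ 0 ≤ x → u x 0 = 0) {t₁ ρ : ℝ}
    (ht₁ : t₁ ∈ times T) (hρ : ρ ∈ Icc 0 (shoreτ x₀ t₁)) :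
    shoreΨ T x₀ ρ = -x₀ 0 + 2 * ρ ^ 2 - 2 * ∫ t in (0 : ℝ)..t₁, max (ρ - shoreτ x₀ t) 0 := by
  obtain ⟨t, ht, rfl⟩ := hflow.exists_shoreτ_eq hbreak hT hu₀ ht₁ hρ
  have htT := times_mono ht₁ ht.1 ht.2
  rw [hflow.shoreΨ_shoreτ hbreak htT,
    hflow.integral_max_shoreτ hbreak ht₁ ht (g := fun y => y) continuous_id rfl,
    intervalIntegral.integral_sub (by simp)
      ((hflow.continuousOn_shoreτ_Icc hbreak htT).intervalIntegrable_of_Icc ht.1),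
    hflow.integral_shoreτ hbreak htT, intervalIntegral.integral_const]
  simp only [shoreτ, smul_eq_mul, sub_zero]
  ring

theorem abel_shoreΨ (hflow : IsFlow T η u x₀) (hbreak : NoBreaking T η u x₀)
    (hT : 0 < T) (hu₀ : ∀ x, x₀ 0 ≤ x → u x 0 = 0) {t₁ b : ℝ}
    (ht₁ : t₁ ∈ times T) (hS : 0 < shoreτ x₀ t₁) (hb : x₀ 0 ≤ b)
    (hb2 : depth η b 0 = shoreτ x₀ t₁ ^ 2) :
    IntervalIntegrable (fun s => shoreΨ T x₀ s / √(shoreτ x₀ t₁ ^ 2 - s ^ 2)) volume 0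
        (shoreτ x₀ t₁) ∧
      abel (shoreΨ T x₀) (shoreτ x₀ t₁) = Real.pi / 2 * (shoreτ x₀ t₁ ^ 2 - b) := by
  set S := shoreτ x₀ t₁ with hSdef
  have h0T : (0 : ℝ) ∈ times T := ⟨le_rfl, hT⟩
  have hdc : ContinuousOn (fun x => depth η x 0) (Icc (x₀ 0) b) := fun y hy =>
    (hflow.hasDerivAt_depth h0T hy.1).continuousAt.continuousWithinAt
  have hθc := hflow.continuousOn_shoreτ_Icc hbreak ht₁
  -- Constant extensions supply the global continuity asked for by `abel_of_integral_identity`.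
  set H : ℝ → ℝ := IccExtend hb ((Icc (x₀ 0) b).domRestrict fun x => depth η x 0) with hH
  set θ : ℝ → ℝ := IccExtend ht₁.1 ((Icc 0 t₁).domRestrict (shoreτ x₀)) with hθ
  have hHeq : ∀ x ∈ Icc (x₀ 0) b, H x = depth η x 0 := fun x hx => by
    rw [hH, IccExtend_of_mem _ _ hx]; rfl
  have hθeq : ∀ t ∈ Icc 0 t₁, θ t = shoreτ x₀ t := fun t ht => by
    rw [hθ, IccExtend_of_mem _ _ ht]; rfl
  have hθI : ∀ ρ, ∫ t in (0 : ℝ)..t₁, max (ρ - θ t) 0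
      = ∫ t in (0 : ℝ)..t₁, max (ρ - shoreτ x₀ t) 0 := fun ρ =>
    intervalIntegral.integral_congr fun t ht => by
      rw [uIcc_of_le ht₁.1] at ht
      simp only [hθeq t ht]
  obtain ⟨hi, hv⟩ := abel_of_integral_identity (h := H) (θ := θ) hb ht₁.1 hS
    hdc.domRestrict.Icc_extend' hθc.domRestrict.Icc_extend'
    (fun x hx => by
      rw [hHeq x (Ioo_subset_Icc_self hx)]
      exact hflow.depth_nonneg h0T hx.1.le)
    (fun x hx => by
      rw [hHeq x (Ioo_subset_Icc_self hx), ← hb2]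
      exact hflow.strictMonoOn_depth hbreak h0T hx.1.le hb hx.2)
    (fun t ht => by
      rw [hθeq t (Ioc_subset_Icc_self ht)]
      exact hflow.shoreτ_nonneg hbreak hT hu₀ (times_mono ht₁ ht.1.le ht.2))
    (fun R hR => by
      have e1 : ∫ x in (x₀ 0)..b, √(R ^ 2 - H x) = ∫ x in (x₀ 0)..b, √(R ^ 2 - depth η x 0) :=
        intervalIntegral.integral_congr fun x hx => by
          rw [uIcc_of_le hb] at hx
          simp only [hHeq x hx]
      have e2 : ∫ t in (0 : ℝ)..t₁, max (R - θ t) 0 ^ 2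
          = ∫ t in (0 : ℝ)..t₁, max (R - shoreτ x₀ t) 0 ^ 2 :=
        intervalIntegral.integral_congr fun t ht => by
          rw [uIcc_of_le ht₁.1] at ht
          simp only [hθeq t ht]
      rw [e1, e2]
      exact hflow.integral_sqrt_eq_max hbreak hT hu₀ ht₁ hb hb2.ge hR)
  obtain ⟨hi', hv'⟩ := integral_quadratic_div_sqrt (-x₀ 0) hS
  have hEq : ∀ ρ ∈ Icc 0 S, (-x₀ 0 + 2 * ρ ^ 2) / √(S ^ 2 - ρ ^ 2)
      - 2 * (∫ t in (0 : ℝ)..t₁, max (ρ - θ t) 0) / √(S ^ 2 - ρ ^ 2)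
      = shoreΨ T x₀ ρ / √(S ^ 2 - ρ ^ 2) := fun ρ hρ => by
    rw [hflow.shoreΨ_eq hbreak hT hu₀ ht₁ hρ, hθI]
    ring
  constructor
  · refine (hi'.sub hi).congr fun ρ hρ => ?_
    rw [uIoc_of_le hS.le] at hρ
    exact hEq ρ (Ioc_subset_Icc_self hρ)
  · rw [abel, ← intervalIntegral.integral_congr fun ρ hρ => hEq ρ (by
      rwa [uIcc_of_le hS.le] at hρ), intervalIntegral.integral_sub hi' hi, hv, hv']
    ring

/-- For t ≤ t₁ one has θ(t) ≤ R - d, so no positive part is active and each such t contributes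
exactly 2d²; later times contribute nonnegatively by convexity. -/
theorem second_difference_ge (hflow : IsFlow T η u x₀) (hbreak : NoBreaking T η u x₀)
    {t₁ t₂ R d : ℝ} (ht₁ : 0 ≤ t₁) (h12 : t₁ ≤ t₂) (ht₂ : t₂ ∈ times T)
    (hd : 0 ≤ d) (hR : R - d = shoreτ x₀ t₁) :
    2 * d ^ 2 * t₁ ≤ (∫ t in (0 : ℝ)..t₂, max (R - d - shoreτ x₀ t) 0 ^ 2)
      + (∫ t in (0 : ℝ)..t₂, max (R + d - shoreτ x₀ t) 0 ^ 2)
      - 2 * ∫ t in (0 : ℝ)..t₂, max (R - shoreτ x₀ t) 0 ^ 2 := by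
  have hθ := hflow.continuousOn_shoreτ_Icc hbreak ht₂
  have hmono := (hflow.strictMonoOn_shoreτ hbreak).monotoneOn
  have h0 : 0 ≤ t₂ := ht₂.1
  have hc : ∀ r : ℝ, ContinuousOn (fun t => max (r - shoreτ x₀ t) 0 ^ 2) (Icc 0 t₂) := fun r =>
    (ContinuousOn.sup (continuousOn_const.sub hθ) continuousOn_const).pow 2
  have hi : ∀ r : ℝ, IntervalIntegrable (fun t => max (r - shoreτ x₀ t) 0 ^ 2) volume 0 t₂ :=
    fun r => (hc r).intervalIntegrable_of_Icc h0
  rw [← intervalIntegral.integral_const_mul, ← intervalIntegral.integral_add (hi _) (hi _),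
    ← intervalIntegral.integral_sub ((hi _).add (hi _)) ((hi _).const_mul 2)]
  have hD : ContinuousOn (fun t => max (R - d - shoreτ x₀ t) 0 ^ 2
      + max (R + d - shoreτ x₀ t) 0 ^ 2 - 2 * max (R - shoreτ x₀ t) 0 ^ 2) (Icc 0 t₂) :=
    ((hc _).add (hc _)).sub (continuousOn_const.mul (hc _))
  rw [← intervalIntegral.integral_add_adjacent_intervals (b := t₁)
    ((hD.mono (Icc_subset_Icc_right h12)).intervalIntegrable_of_Icc ht₁)
    ((hD.mono (Icc_subset_Icc_left ht₁)).intervalIntegrable_of_Icc h12)]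
  have e1 : ∫ t in (0 : ℝ)..t₁, (max (R - d - shoreτ x₀ t) 0 ^ 2
      + max (R + d - shoreτ x₀ t) 0 ^ 2 - 2 * max (R - shoreτ x₀ t) 0 ^ 2)
      = ∫ _ in (0 : ℝ)..t₁, 2 * d ^ 2 := by
    refine intervalIntegral.integral_congr fun t ht => ?_
    rw [uIcc_of_le ht₁] at ht
    have h1 := hmono (times_mono ht₂ ht.1 (ht.2.trans h12)) (times_mono ht₂ ht₁ h12) ht.2
    rw [max_eq_left (by linarith), max_eq_left (by linarith), max_eq_left (by linarith)]
    ring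
  have e2 : 0 ≤ ∫ t in t₁..t₂, (max (R - d - shoreτ x₀ t) 0 ^ 2
      + max (R + d - shoreτ x₀ t) 0 ^ 2 - 2 * max (R - shoreτ x₀ t) 0 ^ 2) := by
    refine intervalIntegral.integral_nonneg h12 fun t _ => ?_
    have := max_sq_second_difference_nonneg (R - shoreτ x₀ t) hd
    rwa [show R - shoreτ x₀ t - d = R - d - shoreτ x₀ t by ring,
      show R - shoreτ x₀ t + d = R + d - shoreτ x₀ t by ring] at this
  rw [e1, intervalIntegral.integral_const, smul_eq_mul, sub_zero]
  linarith

/-- If the wave never breaks, every value of the initial `σ` is observed at the shoreline. -/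
theorem sqrt_depth_mem_observed (hflow : IsFlow T η u x₀) (hbreak : NoBreaking T η u x₀)
    (hT : T = ⊤) (hu₀ : ∀ x, x₀ 0 ≤ x → u x 0 = 0)
    (hx : x₀ 0 ≤ x) : √(depth η x 0) ∈ observed T x₀ := by
  have hT0 : 0 < T := by rw [hT]; exact EReal.zero_lt_top
  have hmem : ∀ t : ℝ, 0 ≤ t → t ∈ times T := fun t ht => ⟨ht, by rw [hT]; exact EReal.coe_lt_top t⟩
  have h0T := hmem 0 le_rfl
  by_contra hcon
  set S := √(depth η x 0) with hS
  have hS0 : 0 ≤ S := Real.sqrt_nonneg _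
  have hlt : ∀ t, 0 ≤ t → shoreτ x₀ t < S := fun t ht => by
    by_contra hge
    push Not at hge
    refine hcon ((hflow.ordConnected_observed hbreak).out (mem_image_of_mem _ h0T)
      (mem_image_of_mem _ (hmem t ht)) ⟨?_, hge⟩)
    rw [hflow.shoreτ_zero hbreak hT0 hu₀]
    exact hS0
  have hSb : depth η x 0 = S ^ 2 := (Real.sq_sqrt (hflow.depth_nonneg h0T hx)).symm
  have hd1 : ∀ y ∈ Icc (x₀ 0) x, ContDiffAt ℝ 1 (fun y => dx η y 0) y := fun y hy =>
    (contDiffAt_dx (hflow.contDiffAt_η h0T hy.1)).comp (f := fun y : ℝ => (y, (0 : ℝ))) y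
      (by fun_prop)
  -- C depends on the initial profile up to x alone and is fixed before any time is chosen.
  obtain ⟨C, hC0, hC⟩ := exists_second_difference_le (h := fun y => depth η y 0)
    (h' := fun y => 1 + dx η y 0) (h'' := deriv fun y => dx η y 0) (S := S) hx
    (fun y hy => hflow.hasDerivAt_depth h0T hy.1)
    (fun y hy => ((hd1 y hy).differentiableAt (by norm_num)).hasDerivAt.const_add 1)
    (fun y hy => by
      have h1 : ContDiffAt ℝ 0 (fderiv ℝ fun y => dx η y 0) y :=
        (hd1 y hy).fderiv_right (by norm_num)
      have h2 : ContinuousAt (fun z => (fderiv ℝ (fun y => dx η y 0) z) 1) y :=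
        h1.continuousAt.clm_apply continuousAt_const
      exact h2.continuousWithinAt)
    (fun y hy => hflow.one_add_dx_pos hbreak h0T hy.1) (hflow.shore_eq 0 h0T) hS0 hSb
  -- Comparing the second differences will give 2t₁ ≤ C, which this choice contradicts.
  set t₁ := C + 1
  have ht₁ : 0 ≤ t₁ := by positivity
  have ht₂ := hmem (t₁ + 1) (by positivity)
  have h12 : shoreτ x₀ t₁ < shoreτ x₀ (t₁ + 1) :=
    hflow.strictMonoOn_shoreτ hbreak (hmem t₁ ht₁) ht₂ (by linarith)
  have hn := hflow.shoreτ_nonneg hbreak hT0 hu₀ (hmem t₁ ht₁)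
  have h2S := hlt (t₁ + 1) (by positivity)
  -- R and d are chosen so that R - d = θ(t₁) and R + d = θ(t₁ + 1), both below S.
  obtain ⟨R, hR⟩ : ∃ R, R = (shoreτ x₀ t₁ + shoreτ x₀ (t₁ + 1)) / 2 := ⟨_, rfl⟩
  obtain ⟨d, hd⟩ : ∃ d, d = (shoreτ x₀ (t₁ + 1) - shoreτ x₀ t₁) / 2 := ⟨_, rfl⟩
  have hd0 : 0 < d := by linarith
  have hge := hflow.second_difference_ge hbreak ht₁ (by linarith) ht₂ hd0.le
    (show R - d = shoreτ x₀ t₁ by rw [hR, hd]; ring)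
  have hle := hC R d hd0.le (by linarith) (by linarith)
  have hSq : shoreτ x₀ (t₁ + 1) ^ 2 ≤ depth η x 0 := by rw [hSb]; gcongr; linarith
  rw [hflow.integral_sqrt_eq_max hbreak hT0 hu₀ ht₂ hx hSq ⟨by linarith, by linarith⟩,
    hflow.integral_sqrt_eq_max hbreak hT0 hu₀ ht₂ hx hSq ⟨by linarith, by linarith⟩,
    hflow.integral_sqrt_eq_max hbreak hT0 hu₀ ht₂ hx hSq ⟨by linarith, by linarith⟩] at hle
  have h3 : 0 < d ^ 2 := by positivity
  have h4 : d ^ 2 * (2 * t₁) ≤ d ^ 2 * C := by linarith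
  have h5 := le_of_mul_le_mul_left h4 h3
  linarith [show t₁ = C + 1 from rfl]

end IsFlow

end SlopingBeach

/-! ### The main theorem. -/

open SlopingBeach in
theorem mainTheorem2 (T : EReal) (hT : 0 < T) (η u : ℝ → ℝ → ℝ) (x₀ η₀ : ℝ → ℝ)
    (hflow : IsFlow T η u x₀)
    (hη₀ : ∀ x, x₀ 0 ≤ x → η x 0 = η₀ x)
    (hu₀ : ∀ x, x₀ 0 ≤ x → u x 0 = 0)
    (hbreak : NoBreaking T η u x₀) :
    -- the shoreline moves with the flow velocity
    (∀ t ∈ times T, HasDerivWithinAt x₀ (u (x₀ t) t) (Set.Ici 0) t) ∧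
    -- `Ψ` is well defined by the shoreline data, on an interval starting at `0`
    (shoreτ x₀ 0 = 0 ∧ StrictMonoOn (shoreτ x₀) (times T) ∧ (observed T x₀).OrdConnected ∧
      ∀ t ∈ times T, shoreΨ T x₀ (shoreτ x₀ t) = -x₀ t + shoreVel x₀ t ^ 2 / 2) ∧
    -- `γ` is well defined on that interval
    (∀ σ ∈ observed T x₀,
      (x₀ 0 ≤ initγ (x₀ 0) η₀ σ ∧ initγ (x₀ 0) η₀ σ + η₀ (initγ (x₀ 0) η₀ σ) = σ ^ 2) ∧
      ∀ x, x₀ 0 ≤ x → x + η₀ x = σ ^ 2 → x = initγ (x₀ 0) η₀ σ) ∧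
    -- `ψ₀ = (2/π) 𝒜Ψ`
    (∀ σ ∈ observed T x₀, 0 < σ →
      IntervalIntegrable (fun s => shoreΨ T x₀ s / Real.sqrt (σ ^ 2 - s ^ 2))
        MeasureTheory.volume 0 σ ∧
      initψ (x₀ 0) η₀ σ = 2 / Real.pi * abel (shoreΨ T x₀) σ) ∧
    -- `η₀(x) = ψ₀(σ)` with `σ = √(x + η₀(x))`, and this implicit equation,
    -- with `ψ₀ = (2/π) 𝒜Ψ`, determines `η₀(x)`
    (∀ x, x₀ 0 < x → Real.sqrt (x + η₀ x) ∈ observed T x₀ →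
      η₀ x = initψ (x₀ 0) η₀ (Real.sqrt (x + η₀ x)) ∧
      η₀ x = 2 / Real.pi * abel (shoreΨ T x₀) (Real.sqrt (x + η₀ x)) ∧
      ∀ y, 0 < x + y → Real.sqrt (x + y) ∈ observed T x₀ →
        y = 2 / Real.pi * abel (shoreΨ T x₀) (Real.sqrt (x + y)) → y = η₀ x) ∧
    η₀ (x₀ 0) = -x₀ 0 ∧
    -- if the wave never breaks, the whole initial displacement is recovered
    (T = ⊤ → ∀ x, x₀ 0 ≤ x → Real.sqrt (x + η₀ x) ∈ observed T x₀) := by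
  have h0T : (0 : ℝ) ∈ times T := ⟨le_rfl, hT⟩
  have hdepth : ∀ x, x₀ 0 ≤ x → depth η x 0 = x + η₀ x := fun x hx => by
    rw [depth_eq_add, hη₀ x hx]
  have hinj : ∀ x y, x₀ 0 ≤ x → x₀ 0 ≤ y → x + η₀ x = y + η₀ y → x = y := fun x y hx hy h => by
    rw [← hdepth x hx, ← hdepth y hy] at h
    exact (hflow.strictMonoOn_depth hbreak h0T).injOn hx hy h
  have hγ : ∀ σ ∈ observed T x₀,
      (x₀ 0 ≤ initγ (x₀ 0) η₀ σ ∧ initγ (x₀ 0) η₀ σ + η₀ (initγ (x₀ 0) η₀ σ) = σ ^ 2) ∧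
      ∀ x, x₀ 0 ≤ x → x + η₀ x = σ ^ 2 → x = initγ (x₀ 0) η₀ σ := by
    rintro σ ⟨t, ht, rfl⟩
    obtain ⟨x, hx, hx2⟩ := hflow.exists_depth_eq_sq hbreak hT hu₀ ht
    rw [hdepth x hx] at hx2
    have hex : ∃ a ∈ Set.Ici (x₀ 0), (fun x => x + η₀ x) a = shoreτ x₀ t ^ 2 := ⟨x, hx, hx2⟩
    have h1 : x₀ 0 ≤ initγ (x₀ 0) η₀ (shoreτ x₀ t) := Function.invFunOn_mem hex
    have h2 : initγ (x₀ 0) η₀ (shoreτ x₀ t) + η₀ (initγ (x₀ 0) η₀ (shoreτ x₀ t))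
      = shoreτ x₀ t ^ 2 := Function.invFunOn_eq hex
    exact ⟨⟨h1, h2⟩, fun y hy hy2 => hinj _ _ hy h1 (hy2.trans h2.symm)⟩
  have habel : ∀ σ ∈ observed T x₀, 0 < σ →
      IntervalIntegrable (fun s => shoreΨ T x₀ s / Real.sqrt (σ ^ 2 - s ^ 2))
        MeasureTheory.volume 0 σ ∧
      initψ (x₀ 0) η₀ σ = 2 / Real.pi * abel (shoreΨ T x₀) σ := by
    intro σ hσ hpos
    obtain ⟨⟨h1, h2⟩, -⟩ := hγ σ hσ
    obtain ⟨t, ht, rfl⟩ := hσ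
    obtain ⟨hi, hv⟩ := hflow.abel_shoreΨ hbreak hT hu₀ ht hpos h1 ((hdepth _ h1).trans h2)
    refine ⟨hi, ?_⟩
    rw [hv, initψ]
    have hpi := Real.pi_pos
    field_simp
    linarith
  refine ⟨fun t ht => hflow.hasDerivWithinAt_shore hbreak ht,
    ⟨hflow.shoreτ_zero hbreak hT hu₀, hflow.strictMonoOn_shoreτ hbreak,
      hflow.ordConnected_observed hbreak, fun t ht => hflow.shoreΨ_shoreτ hbreak ht⟩,
    hγ, habel, fun x hx hmem => ?_, ?_, fun hTop x hx => ?_⟩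
  · have hpos : 0 < x + η₀ x := by
      rw [← hdepth x hx.le]
      exact hflow.depth_pos 0 h0T x hx
    have hx' : x = initγ (x₀ 0) η₀ (Real.sqrt (x + η₀ x)) :=
      (hγ _ hmem).2 x hx.le (Real.sq_sqrt hpos.le).symm
    have hψ : η₀ x = initψ (x₀ 0) η₀ (Real.sqrt (x + η₀ x)) := by
      rw [initψ, ← hx']
    refine ⟨hψ, hψ.trans (habel _ hmem (Real.sqrt_pos.2 hpos)).2, fun y hy hymem hyeq => ?_⟩
    -- The implicit equation says y = η₀(γ) with γ = γ(√(x + y)); since γ + η₀(γ) = x + y, it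
    -- follows that γ = x.
    rw [← (habel _ hymem (Real.sqrt_pos.2 hy)).2, initψ] at hyeq
    obtain ⟨⟨h1, h2⟩, -⟩ := hγ _ hymem
    rw [Real.sq_sqrt hy.le, ← hyeq] at h2
    have h3 : initγ (x₀ 0) η₀ (Real.sqrt (x + y)) = x := by linarith
    rw [h3] at hyeq
    exact hyeq
  · have h := hflow.shore_eq 0 h0T
    rw [hdepth _ le_rfl] at h
    linarith
  · rw [← hdepth x hx]
    exact hflow.sqrt_depth_mem_observed hbreak hTop hu₀ hx
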